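/- Let $(M^n,g)$ be a connected smooth Riemannian manifold (without boundary) of dimension $n>2$, let $X$ be a smooth vector field and $f$ a smooth function on $M$. For an orthonormal pair $(V,U)$ in $T_pM$ put $$\sec_X^V(U)=\sec(V,U)+\tfrac12 (L_Xg)(V,V),\qquad \overline{\sec}_X^V(U)=\sec(V,U)+\tfrac12 (L_Xg)(V,V)+g(X,V)^2,$$ where $\sec(V,U)$ is the sectional curvature of the plane spanned by $V$ and $U$ and $L_Xg$ is the Lie derivative of the metric, and write $\overline{\sec}_f=\overline{\sec}_{\nabla f}$. For a function $\psi:M\to\mathbb R$, "$\sec_X=\psi$" means that $\sec_X^V(U)=\psi(p)$ for all $p\in M$ and all orthonormal pairs $(V,U)$ in $T_pM$; "$\overline{\sec}_f=\psi$" is defined in the same way. Then: 1. $\sec_X=\psi$ for some function $\psi:M\to\mathbb R$ if and only if $g$ has constant sectional curvature and $X$ is a conformal field, i.e. $L_Xg=\varphi g$ for some function $\varphi:M\to\mathbb R$. Moreover, if $\sec_X=K$ for a constant $K\in\mathbb R$, then either $X$ is a Killing field ($L_Xg=0$), or $(M,g)$ is locally isometric to Euclidean space (every point has an open neighbourhood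 isometric to an open subset of Euclidean $\mathbb R^n$) and $X$ is a homothetic field with $L_Xg=2Kg$. 2. $\overline{\sec}_f=\psi$ for some function $\psi:M\to\mathbb R$ if and only if both $g$ and $e^{-2f}g$ have constant sectional curvature. -/

import Mathlib

open Bundle Set
open scoped Manifold ContDiff

noncomputable section

namespace WeightedSec

/-- Smooth Riemannian metrics on the smooth `n`-manifold `M`. -/
abbrev SmoothMetric (n : ℕ) (M : Type*) [TopologicalSpace M]
    [ChartedSpace (EuclideanSpace ℝ (Fin n)) M] [IsManifold (𝓡 n) ∞ M] :=
  ContMDiffRiemannianMetric (𝓡 n) ∞ (EuclideanSpace ℝ (Fin n))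
    (fun x : M => TangentSpace (𝓡 n) x)

/-! ### Christoffel symbols and curvature of a metric on an open subset of `ℝⁿ` -/

section Coordinates

variable {E : Type*} [NormedAddCommGroup E] [NormedSpace ℝ E]

/-- The Christoffel symbols `Γ_y(u, v)` of the metric `G` given on (an open subset of) `E`, i.e.
the vector with
`2 G_y(Γ_y(u, v), w) = (∂_u G)_y(v, w) + (∂_v G)_y(u, w) - (∂_w G)_y(u, v)` for all `w`.
So `∇_U V = ∂_U V + Γ(U, V)` for the Levi-Civita connection `∇` of `G`. -/
def christoffel (G : E → E →L[ℝ] E →L[ℝ] ℝ) (y u v : E) : E :=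
  (G y).inverse ((1 / 2 : ℝ) •
    (fderiv ℝ G y u v + fderiv ℝ G y v u - ((fderiv ℝ G y).flip u).flip v))

/-- The curvature `R(u, v)w = ∇_u ∇_v w - ∇_v ∇_u w` at `y` of the metric `G`, for constant
(hence commuting) vector fields `u, v, w`. -/
def coordCurvature (G : E → E →L[ℝ] E →L[ℝ] ℝ) (y u v w : E) : E :=
  fderiv ℝ (fun z => christoffel G z v w) y u - fderiv ℝ (fun z => christoffel G z u w) y v
    + christoffel G y u (christoffel G y v w) - christoffel G y v (christoffel G y u w)

/-- The Lie derivative `(L_X G)_y(u, v)`, in coordinates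
`X^k ∂_k G_ij + G_kj ∂_i X^k + G_ik ∂_j X^k`. -/
def coordLieDeriv (G : E → E →L[ℝ] E →L[ℝ] ℝ) (X : E → E) (y u v : E) : ℝ :=
  fderiv ℝ G y (X y) u v + G y (fderiv ℝ X y u) v + G y u (fderiv ℝ X y v)

end Coordinates

section Manifold

variable {n : ℕ} {M : Type*} [TopologicalSpace M]
  [ChartedSpace (EuclideanSpace ℝ (Fin n)) M] [IsManifold (𝓡 n) ∞ M]

/-! ### Expressions in the preferred chart around a point `p` -/

/-- The bilinear form `g_x`, on the model space `ℝⁿ` of which `T_x M` is a copy. -/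
def metricForm (g : SmoothMetric n M) (x : M) :
    EuclideanSpace ℝ (Fin n) →L[ℝ] EuclideanSpace ℝ (Fin n) →L[ℝ] ℝ :=
  g.inner x

/-- The derivative at `y` of the inverse of the chart around `p`. -/
def chartInvDeriv (p : M) (y : EuclideanSpace ℝ (Fin n)) :
    EuclideanSpace ℝ (Fin n) →L[ℝ] EuclideanSpace ℝ (Fin n) :=
  mfderiv (𝓡 n) (𝓡 n) (extChartAt (𝓡 n) p).symm y

/-- The metric `g` written in the chart around `p`: the pullback of `g` by the inverse chart. -/
def chartMetric (g : SmoothMetric n M) (p : M) (y : EuclideanSpace ℝ (Fin n)) :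
    EuclideanSpace ℝ (Fin n) →L[ℝ] EuclideanSpace ℝ (Fin n) →L[ℝ] ℝ :=
  (metricForm g ((extChartAt (𝓡 n) p).symm y)).bilinearComp
    (chartInvDeriv p y) (chartInvDeriv p y)

/-- The components in the chart around `p` of a tangent vector `v` at `x`. -/
def chartVec (p x : M) (v : TangentSpace (𝓡 n) x) : EuclideanSpace ℝ (Fin n) :=
  mfderiv (𝓡 n) (𝓡 n) (extChartAt (𝓡 n) p) x v

/-- The vector field `X` written in the chart around `p`. -/
def chartField (X : ∀ x : M, TangentSpace (𝓡 n) x) (p : M) (y : EuclideanSpace ℝ (Fin n)) :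
    EuclideanSpace ℝ (Fin n) :=
  chartVec p ((extChartAt (𝓡 n) p).symm y) (X ((extChartAt (𝓡 n) p).symm y))

/-! ### Curvature and Lie derivative on the manifold -/

/-- `g(R(u, v)v, u)` at the point `p`. -/
def curvatureForm (g : SmoothMetric n M) (p : M) (u v : TangentSpace (𝓡 n) p) : ℝ :=
  chartMetric g p (extChartAt (𝓡 n) p p)
    (coordCurvature (chartMetric g p) (extChartAt (𝓡 n) p p)
      (chartVec p p u) (chartVec p p v) (chartVec p p v))
    (chartVec p p u)

/-- The sectional curvature of the plane spanned by `u` and `v`. -/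
def sec (g : SmoothMetric n M) (p : M) (u v : TangentSpace (𝓡 n) p) : ℝ :=
  curvatureForm g p u v / (g.inner p u u * g.inner p v v - g.inner p u v ^ 2)

/-- The Lie derivative `(L_X g)(u, v)` at the point `p`. -/
def lieDeriv (g : SmoothMetric n M) (X : ∀ x : M, TangentSpace (𝓡 n) x) (p : M)
    (u v : TangentSpace (𝓡 n) p) : ℝ :=
  coordLieDeriv (chartMetric g p) (chartField X p) (extChartAt (𝓡 n) p p)
    (chartVec p p u) (chartVec p p v)

/-- The gradient of `f`: `g(∇f, v) = df(v)` for all `v`. -/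
def gradient (g : SmoothMetric n M) (f : M → ℝ) (p : M) : TangentSpace (𝓡 n) p :=
  (g.inner p).inverse (mfderiv (𝓡 n) 𝓘(ℝ, ℝ) f p)

/-- The pair `(u, v)` is orthonormal. -/
def OrthonormalPair (g : SmoothMetric n M) (p : M) (u v : TangentSpace (𝓡 n) p) : Prop :=
  g.inner p u u = 1 ∧ g.inner p v v = 1 ∧ g.inner p u v = 0

/-- The weighted sectional curvature `sec_X^V(U) = sec(V, U) + ½ (L_X g)(V, V)`. -/
def weightedSec (g : SmoothMetric n M) (X : ∀ x : M, TangentSpace (𝓡 n) x) (p : M)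
    (V U : TangentSpace (𝓡 n) p) : ℝ :=
  sec g p V U + 1 / 2 * lieDeriv g X p V V

/-- The strongly weighted sectional curvature
`sec_X^V(U) = sec(V, U) + ½ (L_X g)(V, V) + g(X, V)²` (written with a bar). -/
def weightedSecBar (g : SmoothMetric n M) (X : ∀ x : M, TangentSpace (𝓡 n) x) (p : M)
    (V U : TangentSpace (𝓡 n) p) : ℝ :=
  sec g p V U + 1 / 2 * lieDeriv g X p V V + g.inner p (X p) V ^ 2

/-- The condition `sec_X = ψ`. -/
def WeightedSecEq (g : SmoothMetric n M) (X : ∀ x : M, TangentSpace (𝓡 n) x) (ψ : M → ℝ) : Prop :=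
  ∀ (p : M) (V U : TangentSpace (𝓡 n) p), OrthonormalPair g p V U → weightedSec g X p V U = ψ p

/-- The condition that the barred weighted curvature of `X` equals `ψ`. -/
def WeightedSecBarEq (g : SmoothMetric n M) (X : ∀ x : M, TangentSpace (𝓡 n) x)
    (ψ : M → ℝ) : Prop :=
  ∀ (p : M) (V U : TangentSpace (𝓡 n) p), OrthonormalPair g p V U → weightedSecBar g X p V U = ψ p

/-- `g` has constant sectional curvature. -/
def HasConstantCurvature (g : SmoothMetric n M) : Prop :=
  ∃ ρ : ℝ, ∀ (p : M) (V U : TangentSpace (𝓡 n) p), OrthonormalPair g p V U → sec g p V U = ρ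

/-- `X` is a conformal field: `L_X g = φ g` for some function `φ`. -/
def IsConformalField (g : SmoothMetric n M) (X : ∀ x : M, TangentSpace (𝓡 n) x) : Prop :=
  ∃ φ : M → ℝ, ∀ (p : M) (u v : TangentSpace (𝓡 n) p), lieDeriv g X p u v = φ p * g.inner p u v

/-- `X` is a homothetic field with constant `c`: `L_X g = c g`. -/
def IsHomotheticField (g : SmoothMetric n M) (X : ∀ x : M, TangentSpace (𝓡 n) x) (c : ℝ) : Prop :=
  ∀ (p : M) (u v : TangentSpace (𝓡 n) p), lieDeriv g X p u v = c * g.inner p u v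

/-- `X` is a Killing field: `L_X g = 0`. -/
def IsKillingField (g : SmoothMetric n M) (X : ∀ x : M, TangentSpace (𝓡 n) x) : Prop :=
  ∀ (p : M) (u v : TangentSpace (𝓡 n) p), lieDeriv g X p u v = 0

/-- The derivative at `x` of a map from `M` to Euclidean space, applied to `v`. -/
def euclDeriv (e : M → EuclideanSpace ℝ (Fin n)) (x : M) (v : TangentSpace (𝓡 n) x) :
    EuclideanSpace ℝ (Fin n) :=
  mfderiv (𝓡 n) (𝓡 n) e x v

/-- `(M, g)` is locally isometric to Euclidean space: around every point there is a smooth chart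
that is an isometry from its domain onto an open subset of Euclidean space. -/
def IsLocallyEuclidean (g : SmoothMetric n M) : Prop :=
  ∀ p : M, ∃ e ∈ IsManifold.maximalAtlas (𝓡 n) ∞ M, p ∈ e.source ∧
    ∀ x ∈ e.source, ∀ u v : TangentSpace (𝓡 n) x,
      g.inner x u v = inner ℝ (euclDeriv e x u) (euclDeriv e x v)

set_option synthInstance.maxHeartbeats 400000 in
/-- The conformal metric `e^{-2f} g`. -/
def conformalMetric (g : SmoothMetric n M) (f : M → ℝ) (hf : ContMDiff (𝓡 n) 𝓘(ℝ, ℝ) ∞ f) :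
    SmoothMetric n M where
  inner x := Real.exp (-2 * f x) • g.inner x
  symm x v w := by
    simp [g.symm x v w]
  pos x v hv := by
    simpa using mul_pos (Real.exp_pos (-2 * f x)) (g.pos x v hv)
  isVonNBounded x := by
    refine ((g.isVonNBounded x).image
      (Real.exp (f x) • ContinuousLinearMap.id ℝ (TangentSpace (𝓡 n) x))).subset ?_
    intro v hv
    refine ⟨Real.exp (-f x) • v, ?_, ?_⟩
    · have h : Real.exp (-f x) * (Real.exp (-f x) * g.inner x v v)
          = Real.exp (-2 * f x) * g.inner x v v := by
        rw [← mul_assoc, ← Real.exp_add]; ring_nf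
      simpa [h] using hv
    · simp [smul_smul, ← Real.exp_add]
  contMDiff := by
    have h : ContMDiff (𝓡 n) 𝓘(ℝ, ℝ) ∞ (fun x => Real.exp (-2 * f x)) :=
      (Real.contDiff_exp.comp (contDiff_const.mul contDiff_id)).contMDiff.comp hf
    intro x
    have hs := g.contMDiff x
    exact h.smul_section g.contMDiff x

end Manifold

end WeightedSec

end

/-!
Sectional curvature is symmetric in the two vectors of an orthonormal pair. So if
`sec(V, U) + B(V, V)` does not depend on the orthonormal pair `(V, U)`, for a symmetric bilinear
form `B`, then `B(V, V) = B(U, U)` for all orthonormal pairs, and in dimension at least three `B` is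
a multiple of the metric (`IsMetricOn.exists_eq_mul`). Then `sec` itself is a function on `M`, and
Schur's lemma (`hasConstantCurvature_of_sec`, from the second Bianchi identity) makes it constant.
With `B = ½ L_X g` this is the equivalence for `sec_X`.

If moreover `sec_X = K` is constant, then so is the conformal factor `c = 2 (K - ρ)`, where `ρ` is
the curvature of `g`. Differentiating the homothety equation twice gives `ρ c = 0`
(`IsMetricOn.mul_eq_zero_of_homothetic`). Either `c = 0` and `X` is a Killing field, or `ρ = 0`,
`c = 2 K`, and the flat metric is locally Euclidean: transporting an orthonormal coframe along the
rays from a point gives a parallel coframe (`exists_parallel_coframe`), which is the derivative of a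
local isometry (`IsMetricOn.exists_isometry_of_flat`).

For a gradient field and the strongly weighted curvature, `B = Hess f + df ⊗ df`, and `B` is also
what governs the conformal change `e^{-2f} g` (`sec_conformal`): for an orthonormal pair of `g`, the
new curvature is `e^{2f} (sec(V, U) + B(V, V) + B(U, U) - |df|²)`. So if `B` is a multiple of `g`
and `sec` is constant, Schur's lemma applies to the new metric. Conversely, if both metrics have
constant curvature, then `B(V, V) + B(U, U)` depends on the point only, and again in dimension at
least three `B` is a multiple of `g`.

The curvature and the Lie derivative of the statement are defined in the preferred chart at each
point. The local arguments take place on open subsets of a vector space, for metrics in the sense of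
`IsMetricOn`; naturality under isometries (`IsIsometryOn`), applied to changes of charts, allows all
points of a chart domain to be treated in the same chart.
-/

noncomputable section

namespace WeightedSec

open Filter Topology

-- Bundled bilinear maps with values in spaces of linear maps need nested instance searches.
set_option maxSynthPendingDepth 3

section Coordinates

variable {E : Type*} [NormedAddCommGroup E] [NormedSpace ℝ E]

/-! ### Derivatives of applications of continuous linear maps -/

section Calculus

variable {F₁ F₂ F₃ : Type*} [NormedAddCommGroup F₁] [NormedSpace ℝ F₁]
  [NormedAddCommGroup F₂] [NormedSpace ℝ F₂] [NormedAddCommGroup F₃] [NormedSpace ℝ F₃]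

theorem fderiv_clm_apply_apply {H : E → F₁ →L[ℝ] F₂} {a : E → F₁} {y : E}
    (hH : DifferentiableAt ℝ H y) (ha : DifferentiableAt ℝ a y) (u : E) :
    fderiv ℝ (fun z => H z (a z)) y u = fderiv ℝ H y u (a y) + H y (fderiv ℝ a y u) := by
  rw [fderiv_clm_apply hH ha]
  simp [add_comm]

theorem fderiv_clm_apply₂_apply {H : E → F₁ →L[ℝ] F₂ →L[ℝ] F₃} {a : E → F₁} {b : E → F₂} {y : E}
    (hH : DifferentiableAt ℝ H y) (ha : DifferentiableAt ℝ a y) (hb : DifferentiableAt ℝ b y)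
    (u : E) :
    fderiv ℝ (fun z => H z (a z) (b z)) y u =
      fderiv ℝ H y u (a y) (b y) + H y (fderiv ℝ a y u) (b y) + H y (a y) (fderiv ℝ b y u) := by
  rw [fderiv_clm_apply_apply (hH.clm_apply ha) hb, fderiv_clm_apply_apply hH ha]
  simp

theorem _root_.ContDiffAt.snd_fderiv_symm {H : E → F₁} {y : E} (hH : ContDiffAt ℝ ∞ H y) (u v : E) :
    fderiv ℝ (fderiv ℝ H) y u v = fderiv ℝ (fderiv ℝ H) y v u :=
  (hH.isSymmSndFDerivAt (by simpa using (WithTop.coe_le_coe.2 (le_top : (2 : ℕ∞) ≤ ⊤)))) u v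

theorem _root_.ContDiffAt.fderiv_smooth {H : E → F₁} {y : E} (hH : ContDiffAt ℝ ∞ H y) :
    ContDiffAt ℝ ∞ (fderiv ℝ H) y :=
  hH.fderiv_right (by simp)

theorem _root_.ContDiffAt.differentiableAt_of_smooth {H : E → F₁} {y : E}
    (hH : ContDiffAt ℝ ∞ H y) :
    DifferentiableAt ℝ H y := hH.differentiableAt (by simp)

end Calculus

/-! ### The Levi-Civita connection and its curvature in coordinates -/

/-- The curvature `R(u, v) = ∂_u Γ_v - ∂_v Γ_u + [Γ_u, Γ_v]` of the connection
`∇_u = ∂_u + Γ_u`, where `Γ_u = Γ y u` is an endomorphism of `E`. Bundled as a trilinear map, unlike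
`coordCurvature`, so that it is defined for an arbitrary connection form. -/
def curv (Γ : E → E →L[ℝ] E →L[ℝ] E) (y : E) : E →L[ℝ] E →L[ℝ] E →L[ℝ] E :=
  fderiv ℝ Γ y - (fderiv ℝ Γ y).flip
    + (ContinuousLinearMap.compL ℝ E E E).bilinearComp (Γ y) (Γ y)
    - ((ContinuousLinearMap.compL ℝ E E E).bilinearComp (Γ y) (Γ y)).flip

theorem curv_apply (Γ : E → E →L[ℝ] E →L[ℝ] E) (y u v : E) :
    curv Γ y u v = fderiv ℝ Γ y u v - fderiv ℝ Γ y v u + Γ y u ∘L Γ y v - Γ y v ∘L Γ y u := by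
  simp [curv]

theorem curv_apply_apply (Γ : E → E →L[ℝ] E →L[ℝ] E) (y u v w : E) :
    curv Γ y u v w = fderiv ℝ Γ y u v w - fderiv ℝ Γ y v u w + Γ y u (Γ y v w)
      - Γ y v (Γ y u w) := by
  simp [curv]

theorem curv_swap (Γ : E → E →L[ℝ] E →L[ℝ] E) (y u v w : E) :
    curv Γ y u v w = - curv Γ y v u w := by
  simp only [curv_apply_apply]; abel

/-- The Christoffel symbols `christoffel G y`, bundled as a bilinear map. -/
def chr (G : E → E →L[ℝ] E →L[ℝ] ℝ) (y : E) : E →L[ℝ] E →L[ℝ] E :=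
  (ContinuousLinearMap.compL ℝ E (E →L[ℝ] ℝ) E (G y).inverse) ∘L
    ((1 / 2 : ℝ) • (fderiv ℝ G y + (fderiv ℝ G y).flip
      - (ContinuousLinearMap.flipₗᵢ ℝ E E ℝ).toContinuousLinearEquiv.toContinuousLinearMap ∘L
          (fderiv ℝ G y).flip))

theorem chr_apply (G : E → E →L[ℝ] E →L[ℝ] ℝ) (y u v : E) : chr G y u v = christoffel G y u v := by
  simp [chr, christoffel]

/-- `G` is a smooth Riemannian metric on the open set `s` of the vector space `E`. -/
structure IsMetricOn (G : E → E →L[ℝ] E →L[ℝ] ℝ) (s : Set E) : Prop where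
  isOpen : IsOpen s
  contDiffOn : ContDiffOn ℝ ∞ G s
  symm : ∀ y ∈ s, ∀ u v, G y u v = G y v u
  pos : ∀ y ∈ s, ∀ u, u ≠ 0 → 0 < G y u u

namespace IsMetricOn

variable {G : E → E →L[ℝ] E →L[ℝ] ℝ} {s : Set E} {y : E}

theorem contDiffAt (hG : IsMetricOn G s) (hy : y ∈ s) : ContDiffAt ℝ ∞ G y :=
  hG.contDiffOn.contDiffAt (hG.isOpen.mem_nhds hy)

theorem differentiableAt (hG : IsMetricOn G s) (hy : y ∈ s) : DifferentiableAt ℝ G y :=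
  (hG.contDiffAt hy).differentiableAt_of_smooth

theorem ext (hG : IsMetricOn G s) (hy : y ∈ s) {u v : E} (h : ∀ w, G y u w = G y v w) : u = v := by
  by_contra hne
  have := hG.pos y hy (u - v) (sub_ne_zero.2 hne)
  simp [h (u - v)] at this

theorem fderiv_symm (hG : IsMetricOn G s) (hy : y ∈ s) (u v w : E) :
    fderiv ℝ G y u v w = fderiv ℝ G y u w v := by
  have h : (fun z => G z v w) =ᶠ[𝓝 y] fun z => G z w v := by
    filter_upwards [hG.isOpen.mem_nhds hy] with z hz using hG.symm z hz v w
  have := DFunLike.congr_fun (h.fderiv_eq (𝕜 := ℝ)) u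
  simpa [fderiv_clm_apply₂_apply (hG.differentiableAt hy) (differentiableAt_const _)
    (differentiableAt_const _)] using this

variable [FiniteDimensional ℝ E]

/-- A metric at a point, as an isomorphism of `E` with its dual. -/
def equivDual (hG : IsMetricOn G s) (hy : y ∈ s) : E ≃L[ℝ] (E →L[ℝ] ℝ) :=
  (LinearEquiv.ofInjectiveOfFinrankEq (G y : E →ₗ[ℝ] (E →L[ℝ] ℝ))
    (fun u v h => hG.ext hy fun w => by simpa using congrArg (fun L => L w) h) (by
      rw [← (LinearMap.toContinuousLinearMap : (E →ₗ[ℝ] ℝ) ≃ₗ[ℝ] (E →L[ℝ] ℝ)).finrank_eq]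
      exact Subspace.dual_finrank_eq.symm)).toContinuousLinearEquiv

theorem coe_equivDual (hG : IsMetricOn G s) (hy : y ∈ s) :
    (hG.equivDual hy : E →L[ℝ] (E →L[ℝ] ℝ)) = G y := by
  ext u v
  rfl

theorem apply_inverse (hG : IsMetricOn G s) (hy : y ∈ s) (l : E →L[ℝ] ℝ) :
    G y ((G y).inverse l) = l := by
  rw [← hG.coe_equivDual hy, ContinuousLinearMap.inverse_equiv]
  simp

theorem contDiffAt_inverse (hG : IsMetricOn G s) (hy : y ∈ s) :
    ContDiffAt ℝ ∞ (fun z => (G z).inverse) y := by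
  have h := contDiffAt_map_inverse (𝕜 := ℝ) (n := ∞) (hG.equivDual hy)
  rw [hG.coe_equivDual hy] at h
  exact h.comp y (hG.contDiffAt hy)

theorem apply_chr (hG : IsMetricOn G s) (hy : y ∈ s) (u v w : E) :
    G y (chr G y u v) w =
      1 / 2 * (fderiv ℝ G y u v w + fderiv ℝ G y v u w - fderiv ℝ G y w u v) := by
  rw [chr_apply, christoffel, hG.apply_inverse hy]
  simp

theorem chr_symm (hG : IsMetricOn G s) (hy : y ∈ s) (u v : E) : chr G y u v = chr G y v u := by
  refine hG.ext hy fun w => ?_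
  rw [hG.apply_chr hy, hG.apply_chr hy, hG.fderiv_symm hy w u v]
  ring

/-- The Levi-Civita connection is compatible with the metric. -/
theorem fderiv_eq (hG : IsMetricOn G s) (hy : y ∈ s) (u v w : E) :
    fderiv ℝ G y u v w = G y (chr G y u v) w + G y v (chr G y u w) := by
  rw [hG.symm y hy v, hG.apply_chr hy, hG.apply_chr hy, hG.fderiv_symm hy v u w,
    hG.fderiv_symm hy w u v, hG.fderiv_symm hy u v w]
  ring

theorem contDiffAt_chr (hG : IsMetricOn G s) (hy : y ∈ s) : ContDiffAt ℝ ∞ (chr G) y := by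
  have h1 := hG.contDiffAt_inverse hy
  have h2 := (hG.contDiffAt hy).fderiv_smooth
  unfold chr
  have hf : ContDiffAt ℝ ∞ (fun z => (fderiv ℝ G z).flip) y :=
    (ContinuousLinearMap.flipₗᵢ ℝ E E (E →L[ℝ] ℝ)).contDiff.contDiffAt.comp y h2
  refine ContDiffAt.clm_comp ?_ (ContDiffAt.const_smul _ ((h2.add hf).sub ?_))
  · exact (ContinuousLinearMap.contDiff _).contDiffAt.comp y h1
  · exact contDiffAt_const.clm_comp hf

theorem differentiableAt_chr (hG : IsMetricOn G s) (hy : y ∈ s) : DifferentiableAt ℝ (chr G) y :=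
  (hG.contDiffAt_chr hy).differentiableAt_of_smooth

theorem coordCurvature_eq (hG : IsMetricOn G s) (hy : y ∈ s) (u v w : E) :
    coordCurvature G y u v w = curv (chr G) y u v w := by
  have h : ∀ a b c : E, fderiv ℝ (fun z => christoffel G z b c) y a = fderiv ℝ (chr G) y a b c := by
    intro a b c
    simp_rw [← chr_apply]
    simpa using fderiv_clm_apply₂_apply (hG.differentiableAt_chr hy)
      (differentiableAt_const b) (differentiableAt_const c) a
  rw [coordCurvature, curv_apply_apply, h, h]
  simp only [chr_apply]

theorem fderiv_chr_symm (hG : IsMetricOn G s) (hy : y ∈ s) (u v w : E) :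
    fderiv ℝ (chr G) y u v w = fderiv ℝ (chr G) y u w v := by
  have h : (fun z => chr G z v w) =ᶠ[𝓝 y] fun z => chr G z w v := by
    filter_upwards [hG.isOpen.mem_nhds hy] with z hz using hG.chr_symm hz v w
  have := DFunLike.congr_fun (h.fderiv_eq (𝕜 := ℝ)) u
  simpa [fderiv_clm_apply₂_apply (hG.differentiableAt_chr hy) (differentiableAt_const _)
    (differentiableAt_const _)] using this

/-- The first Bianchi identity. -/
theorem curv_cyclic (hG : IsMetricOn G s) (hy : y ∈ s) (u v w : E) :
    curv (chr G) y u v w + curv (chr G) y v w u + curv (chr G) y w u v = 0 := by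
  simp only [curv_apply_apply]
  rw [hG.fderiv_chr_symm hy u w v, hG.fderiv_chr_symm hy v w u, hG.fderiv_chr_symm hy w v u,
    hG.chr_symm hy w v, hG.chr_symm hy u w, hG.chr_symm hy v u]
  abel

/-- The curvature endomorphisms are skew: differentiate `∂_b G (w, w) = 2 G(Γ_b w, w)` in the
direction `a` and use that second derivatives commute. -/
theorem curv_apply_self (hG : IsMetricOn G s) (hy : y ∈ s) (u v w : E) :
    G y (curv (chr G) y u v w) w = 0 := by
  have key : ∀ a b : E, fderiv ℝ (fderiv ℝ G) y a b w w =
      2 * (G y (fderiv ℝ (chr G) y a b w) w + G y (chr G y a (chr G y b w)) w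
        + G y (chr G y b w) (chr G y a w)) := by
    intro a b
    have h : (fun z => fderiv ℝ G z b w w) =ᶠ[𝓝 y] fun z => 2 * G z (chr G z b w) w := by
      filter_upwards [hG.isOpen.mem_nhds hy] with z hz
      rw [hG.fderiv_eq hz, hG.symm z hz w]; ring
    have h1 := DFunLike.congr_fun (h.fderiv_eq (𝕜 := ℝ)) a
    have hd := (hG.contDiffAt hy).fderiv_smooth.differentiableAt_of_smooth
    have hc : DifferentiableAt ℝ (fun z => chr G z b w) y :=
      ((hG.differentiableAt_chr hy).clm_apply (differentiableAt_const _)).clm_apply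
        (differentiableAt_const _)
    have hw := differentiableAt_const (𝕜 := ℝ) (x := y) w
    have hb := differentiableAt_const (𝕜 := ℝ) (x := y) b
    have e1 : fderiv ℝ (fun z => fderiv ℝ G z b w w) y a = fderiv ℝ (fderiv ℝ G) y a b w w := by
      rw [fderiv_clm_apply₂_apply (hd.clm_apply hb) hw hw, fderiv_clm_apply_apply hd hb]
      simp
    have e2 : fderiv ℝ (fun z => 2 * G z (chr G z b w) w) y a =
        2 * (fderiv ℝ G y a (chr G y b w) w + G y (fderiv ℝ (chr G) y a b w) w) := by
      rw [fderiv_const_mul (((hG.differentiableAt hy).clm_apply hc).clm_apply hw)]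
      rw [smul_apply, fderiv_clm_apply₂_apply (hG.differentiableAt hy) hc hw,
        fderiv_clm_apply₂_apply (hG.differentiableAt_chr hy) hb hw]
      simp
    simp only [e1, e2] at h1
    rw [h1, hG.fderiv_eq hy]
    ring
  have hs := (hG.contDiffAt hy).snd_fderiv_symm u v
  have h1 := key u v
  have h2 := key v u
  rw [hs] at h1
  rw [curv_apply_apply]
  simp only [map_add, map_sub, add_apply, sub_apply]
  have := hG.symm y hy (chr G y v w) (chr G y u w)
  linarith

theorem curv_skew (hG : IsMetricOn G s) (hy : y ∈ s) (u v w z : E) :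
    G y (curv (chr G) y u v w) z = - G y (curv (chr G) y u v z) w := by
  have h := hG.curv_apply_self hy u v (w + z)
  simp only [map_add, add_apply] at h
  linarith [hG.curv_apply_self hy u v w, hG.curv_apply_self hy u v z]

/-- The curvature form `g(R(u, v)v, u)` is symmetric in `u` and `v`. -/
theorem curv_form_symm (hG : IsMetricOn G s) (hy : y ∈ s) (u v : E) :
    G y (curv (chr G) y u v v) u = G y (curv (chr G) y v u u) v := by
  rw [hG.curv_skew hy, curv_swap]; simp

end IsMetricOn

end Coordinates

/-! ### Curvature tensors and sectional curvature -/

/-- A curvature-like tensor whose sectional curvatures vanish is zero. -/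
theorem curvatureLike_eq_zero {E : Type*} [AddCommGroup E] {T : E → E → E → E → ℝ}
    (add₁ : ∀ u u' v w z, T (u + u') v w z = T u v w z + T u' v w z)
    (add₃ : ∀ u v w w' z, T u v (w + w') z = T u v w z + T u v w' z)
    (skew₁ : ∀ u v w z, T u v w z = - T v u w z)
    (skew₃ : ∀ u v w z, T u v w z = - T u v z w)
    (cyclic : ∀ u v w z, T u v w z + T v w u z + T w u v z = 0)
    (diag : ∀ u v, T u v v u = 0) (u v w z : E) : T u v w z = 0 := by
  -- pair symmetry, from the four cyclic identities of the octahedron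
  have pair : ∀ u v w z, T u v w z = T w z u v := by
    intro u v w z
    linarith [cyclic u v w z, cyclic v w z u, cyclic w z u v, cyclic z u v w,
      skew₃ v w u z, skew₁ w u v z, skew₃ w u v z, skew₃ u v z w, skew₃ v z w u, skew₁ w z u v,
      skew₁ z u v w, skew₃ z u w v, skew₁ z v w u, skew₃ z v w u, skew₁ u z w v, skew₃ w z v u,
      skew₁ z w v u, skew₃ u z w v, skew₁ v z u w, skew₃ v w z u, skew₃ w u z v, skew₁ u w z v]
  -- polarizing `diag` in the inner and then in the outer pair of arguments
  have s1 : ∀ u v w, T u v w u = 0 := by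
    intro u v w
    have h := diag u (v + w)
    rw [add₃, skew₁ u (v + w), skew₁ u (v + w), add₁, add₁] at h
    linarith [diag u v, diag u w, skew₁ u v v u, skew₁ u w w u, skew₁ u v w u, skew₁ u w v u,
      pair u w v u, skew₁ v u u w, skew₃ u v u w]
  have s2 : ∀ u v w z, T u v w z = - T z v w u := by
    intro u v w z
    have h := s1 (u + z) v w
    rw [add₁, skew₃ u, skew₃ z, add₃, add₃] at h
    linarith [s1 u v w, s1 z v w, skew₃ u v w u, skew₃ u v w z, skew₃ z v w u, skew₃ z v w z]
  linarith [cyclic u v w z, s2 v w u z, s2 w u v z, skew₁ v w u z, skew₁ w u v z,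
    pair z w u v, skew₁ z w u v, skew₃ u v z w, s2 u w v z, pair z u v w, skew₁ u z v w,
    skew₃ u v w z, pair v w u z, pair w u v z, s2 u v w z, skew₁ z v w u, skew₃ z v w u,
    pair v z w u, s2 z w v u, skew₃ v w z u, s2 v z w u]

namespace IsMetricOn

variable {E : Type*} [NormedAddCommGroup E] [NormedSpace ℝ E]
variable {G : E → E →L[ℝ] E →L[ℝ] ℝ} {s : Set E} {y : E}

theorem mono (hG : IsMetricOn G s) {t : Set E} (ht : IsOpen t) (hts : t ⊆ s) : IsMetricOn G t :=
  ⟨ht, hG.contDiffOn.mono hts, fun y hy => hG.symm y (hts hy), fun y hy => hG.pos y (hts hy)⟩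

theorem exists_unit_smul (hG : IsMetricOn G s) (hy : y ∈ s) {u : E} (hu : u ≠ 0) :
    ∃ a : ℝ, 0 < a ∧ G y (a⁻¹ • u) (a⁻¹ • u) = 1 := by
  have h := hG.pos y hy u hu
  refine ⟨√(G y u u), Real.sqrt_pos.2 h, ?_⟩
  have h2 := Real.mul_self_sqrt h.le
  have h3 := (Real.sqrt_pos.2 h).ne'
  simp only [map_smul, smul_apply, smul_eq_mul]
  field_simp
  nlinarith

/-- In dimension at least three there is a unit vector orthogonal to any two given ones. -/
theorem exists_unit_orthogonal [FiniteDimensional ℝ E] (hG : IsMetricOn G s) (hy : y ∈ s)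
    (hE : 2 < Module.finrank ℝ E) (a b : E) :
    ∃ w, G y w w = 1 ∧ G y a w = 0 ∧ G y b w = 0 := by
  have hk : LinearMap.ker ((G y a : E →ₗ[ℝ] ℝ).prod (G y b : E →ₗ[ℝ] ℝ)) ≠ ⊥ :=
    LinearMap.ker_ne_bot_of_finrank_lt (by simpa using hE)
  obtain ⟨w, hw, hw0⟩ := Submodule.exists_mem_ne_zero_of_ne_bot hk
  obtain ⟨c, -, hc⟩ := hG.exists_unit_smul hy hw0
  have hw' : G y a w = 0 ∧ G y b w = 0 := by simpa using hw
  exact ⟨c⁻¹ • w, hc, by simp [hw'.1], by simp [hw'.2]⟩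

variable [FiniteDimensional ℝ E]

/-- If all planes at `y` have sectional curvature `κ`, the curvature tensor is that of the space
form. -/
theorem curv_eq_of_sec_eq (hG : IsMetricOn G s) (hy : y ∈ s) {κ : ℝ}
    (h : ∀ u v, G y u u = 1 → G y v v = 1 → G y u v = 0 → G y (curv (chr G) y u v v) u = κ)
    (u v w : E) : curv (chr G) y u v w = κ • (G y v w • u - G y u w • v) := by
  have diag : ∀ u v, G y (curv (chr G) y u v v) u = κ * (G y u u * G y v v - G y u v ^ 2) := by
    intro u v
    rcases eq_or_ne u 0 with rfl | hu
    · simp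
    obtain ⟨a, ha, hau⟩ := hG.exists_unit_smul hy hu
    obtain ⟨e, he⟩ : ∃ e, e = a⁻¹ • u := ⟨_, rfl⟩
    have hue : u = a • e := by rw [he, smul_smul, mul_inv_cancel₀ ha.ne', one_smul]
    rw [← he] at hau
    -- the component of `v` orthogonal to `e`
    obtain ⟨v', hv'⟩ : ∃ v', v' = v - G y e v • e := ⟨_, rfl⟩
    have hev' : G y e v' = 0 := by simp [hv', hau]
    have hvv' : v = G y e v • e + v' := by rw [hv']; abel
    have hself : curv (chr G) y e e = 0 := by
      ext x
      simp [curv_apply_apply]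
    have hself' := hG.curv_apply_self hy e v' e
    generalize G y e v = b at hvv'
    subst hvv' hue
    have hred : G y (curv (chr G) y e v' v') e = κ * G y v' v' := by
      rcases eq_or_ne v' 0 with h0 | h0
      · simp [h0]
      obtain ⟨c, hc, hcu⟩ := hG.exists_unit_smul hy h0
      have := h e (c⁻¹ • v') hau hcu (by simp [hev'])
      simp only [map_smul, smul_apply, smul_eq_mul] at this hcu
      field_simp at this hcu
      rw [this, hcu, mul_comm]
    have hs : G y v' e = 0 := by rw [hG.symm y hy]; exact hev'
    simp only [map_smul, map_add, add_apply, smul_apply, smul_eq_mul, hau, hev', hself, hred,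
      hself', hs, zero_apply, map_zero]
    ring
  refine hG.ext hy fun z => ?_
  have key := curvatureLike_eq_zero
    (T := fun u v w z => G y (curv (chr G) y u v w) z - κ * (G y v w * G y u z - G y u w * G y v z))
    (by intros; simp only [map_add, add_apply]; ring)
    (by intros; simp only [map_add, add_apply]; ring)
    (by intro u v w z; rw [curv_swap]; simp only [map_neg, neg_apply]; ring)
    (by intro u v w z; rw [hG.curv_skew hy]; ring)
    (by
      intro u v w z
      have := congrArg (fun x => G y x z) (hG.curv_cyclic hy u v w)
      simp only [map_add, add_apply, map_zero, zero_apply] at this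
      rw [hG.symm y hy w u, hG.symm y hy w v, hG.symm y hy v u]
      linarith)
    (by intro u v; rw [diag, hG.symm y hy v u]; ring) u v w z
  simp only [map_smul, map_sub, smul_apply, sub_apply, smul_eq_mul]
  linarith

end IsMetricOn

/-! ### The second Bianchi identity and Schur's lemma -/

section Bianchi

variable {E : Type*} [NormedAddCommGroup E] [NormedSpace ℝ E]

theorem fderiv_curv_apply {Γ : E → E →L[ℝ] E →L[ℝ] E} {y : E} (hΓ : ContDiffAt ℝ ∞ Γ y)
    (u v w z : E) :
    fderiv ℝ (fun x => curv Γ x v w z) y u =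
      fderiv ℝ (fderiv ℝ Γ) y u v w z - fderiv ℝ (fderiv ℝ Γ) y u w v z
      + fderiv ℝ Γ y u v (Γ y w z) + Γ y v (fderiv ℝ Γ y u w z)
      - fderiv ℝ Γ y u w (Γ y v z) - Γ y w (fderiv ℝ Γ y u v z) := by
  have hd := hΓ.fderiv_smooth.differentiableAt_of_smooth
  have h0 := hΓ.differentiableAt_of_smooth
  have hc : ∀ a : E, DifferentiableAt ℝ (fun _ : E => a) y := fun a => differentiableAt_const a
  have hb : ∀ a b : E, DifferentiableAt ℝ (fun x => Γ x a b) y := fun a b =>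
    (h0.clm_apply (hc a)).clm_apply (hc b)
  have hdd : ∀ a b c : E, DifferentiableAt ℝ (fun x => fderiv ℝ Γ x a b c) y := fun a b c =>
    ((hd.clm_apply (hc a)).clm_apply (hc b)).clm_apply (hc c)
  have hbb : ∀ a b c : E, DifferentiableAt ℝ (fun x => Γ x a (Γ x b c)) y := fun a b c =>
    (h0.clm_apply (hc a)).clm_apply (hb b c)
  have e1 : ∀ a b c, fderiv ℝ (fun x => fderiv ℝ Γ x a b c) y u =
      fderiv ℝ (fderiv ℝ Γ) y u a b c := by
    intro a b c
    rw [fderiv_clm_apply₂_apply (hd.clm_apply (hc a)) (hc b) (hc c),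
      fderiv_clm_apply_apply hd (hc a)]
    simp
  have e2 : ∀ a b c, fderiv ℝ (fun x => Γ x a (Γ x b c)) y u =
      fderiv ℝ Γ y u a (Γ y b c) + Γ y a (fderiv ℝ Γ y u b c) := by
    intro a b c
    rw [fderiv_clm_apply₂_apply h0 (hc a) (hb b c), fderiv_clm_apply₂_apply h0 (hc b) (hc c)]
    simp
  simp only [curv_apply_apply]
  rw [fderiv_fun_sub (((hdd _ _ _).fun_sub (hdd _ _ _)).fun_add (hbb _ _ _)) (hbb _ _ _),
    fderiv_fun_add ((hdd _ _ _).fun_sub (hdd _ _ _)) (hbb _ _ _),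
    fderiv_fun_sub (hdd _ _ _) (hdd _ _ _)]
  simp only [sub_apply, add_apply, e1, e2]
  abel

/-- The second Bianchi identity, for an arbitrary connection form. -/
theorem second_bianchi {Γ : E → E →L[ℝ] E →L[ℝ] E} {y : E} (hΓ : ContDiffAt ℝ ∞ Γ y)
    (u v w z : E) :
    (fderiv ℝ (fun x => curv Γ x v w z) y u + Γ y u (curv Γ y v w z) - curv Γ y v w (Γ y u z))
    + (fderiv ℝ (fun x => curv Γ x w u z) y v + Γ y v (curv Γ y w u z) - curv Γ y w u (Γ y v z))
    + (fderiv ℝ (fun x => curv Γ x u v z) y w + Γ y w (curv Γ y u v z) - curv Γ y u v (Γ y w z))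
      = 0 := by
  rw [fderiv_curv_apply hΓ u v w z, fderiv_curv_apply hΓ v w u z, fderiv_curv_apply hΓ w u v z]
  simp only [curv_apply_apply, map_add, map_sub]
  rw [hΓ.snd_fderiv_symm v u, hΓ.snd_fderiv_symm w u, hΓ.snd_fderiv_symm w v]
  abel

end Bianchi

namespace IsMetricOn

variable {E : Type*} [NormedAddCommGroup E] [NormedSpace ℝ E] [FiniteDimensional ℝ E]
variable {G : E → E →L[ℝ] E →L[ℝ] ℝ} {s : Set E} {y : E}

theorem contDiffAt_curv (hG : IsMetricOn G s) (hy : y ∈ s) (u v w : E) :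
    ContDiffAt ℝ ∞ (fun z => curv (chr G) z u v w) y := by
  have h := hG.contDiffAt_chr hy
  have hd := h.fderiv_smooth
  have hc : ∀ a : E, ContDiffAt ℝ ∞ (fun _ : E => a) y := fun a => contDiffAt_const
  simp only [curv_apply_apply]
  exact ((((hd.clm_apply (hc u)).clm_apply (hc v)).clm_apply (hc w)).sub
    (((hd.clm_apply (hc v)).clm_apply (hc u)).clm_apply (hc w))).add
    ((h.clm_apply (hc u)).clm_apply ((h.clm_apply (hc v)).clm_apply (hc w))) |>.sub
    ((h.clm_apply (hc v)).clm_apply ((h.clm_apply (hc u)).clm_apply (hc w)))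

/-- **Schur's lemma** in coordinates: by the second Bianchi identity the derivative of a pointwise
sectional curvature `κ` vanishes. No regularity of `κ` is assumed; it is a quotient of smooth
functions. -/
theorem hasFDerivAt_sec_zero (hG : IsMetricOn G s) (hE : 2 < Module.finrank ℝ E) {κ : E → ℝ}
    (h : ∀ z ∈ s, ∀ u v w, curv (chr G) z u v w = κ z • (G z v w • u - G z u w • v)) (hy : y ∈ s) :
    HasFDerivAt κ (0 : E →L[ℝ] ℝ) y := by
  have hc : ∀ a : E, DifferentiableAt ℝ (fun _ : E => a) y := fun a => differentiableAt_const a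
  have hG0 := hG.differentiableAt hy
  have hGab : ∀ a b : E, DifferentiableAt ℝ (fun z => G z a b) y := fun a b =>
    (hG0.clm_apply (hc a)).clm_apply (hc b)
  have hdiff : DifferentiableAt ℝ κ y := by
    obtain ⟨u, hu, -, -⟩ := hG.exists_unit_orthogonal hy hE 0 0
    obtain ⟨v, hv, huv, -⟩ := hG.exists_unit_orthogonal hy hE u u
    have hD : DifferentiableAt ℝ (fun z => G z u u * G z v v - G z u v * G z u v) y :=
      ((hGab u u).fun_mul (hGab v v)).fun_sub ((hGab u v).fun_mul (hGab u v))
    have hDy : G y u u * G y v v - G y u v * G y u v ≠ 0 := by simp [hu, hv, huv]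
    have hN : DifferentiableAt ℝ (fun z => G z (curv (chr G) z u v v) u) y :=
      (hG0.clm_apply (hG.contDiffAt_curv hy u v v).differentiableAt_of_smooth).clm_apply (hc u)
    refine (hN.fun_mul (DifferentiableAt.fun_inv hD hDy)).congr_of_eventuallyEq ?_
    filter_upwards [hG.isOpen.mem_nhds hy, hD.continuousAt.eventually_ne hDy] with z hz hz0
    rw [← div_eq_mul_inv, eq_div_iff hz0, h z hz]
    simp only [map_smul, map_sub, smul_apply, sub_apply, smul_eq_mul]
    rw [hG.symm z hz v u]
    ring
  have hfd : ∀ u v w z, fderiv ℝ (fun x => curv (chr G) x v w z) y u =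
      fderiv ℝ κ y u • (G y w z • v - G y v z • w)
      + κ y • (fderiv ℝ G y u w z • v - fderiv ℝ G y u v z • w) := by
    intro u v w z
    have he : (fun x => curv (chr G) x v w z) =ᶠ[𝓝 y]
        fun x => κ x • (G x w z • v - G x v z • w) := by
      filter_upwards [hG.isOpen.mem_nhds hy] with x hx using h x hx v w z
    have h1 : ∀ a b c : E, fderiv ℝ (fun x => G x a b • c) y u = fderiv ℝ G y u a b • c := by
      intro a b c
      rw [fderiv_smul_const (hGab a b)]
      simp [fderiv_clm_apply₂_apply hG0 (hc a) (hc b)]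
    rw [he.fderiv_eq, fderiv_fun_smul hdiff
      (((hGab w z).smul_const v).fun_sub ((hGab v z).smul_const w)),
      fderiv_fun_sub ((hGab w z).smul_const v) ((hGab v z).smul_const w)]
    simp only [add_apply, smul_apply, sub_apply, h1, ContinuousLinearMap.smulRight_apply]
    abel
  -- the terms with `κ y` in the Bianchi identity cancel, since the metric is parallel
  have key : ∀ u v w z, fderiv ℝ κ y u • (G y w z • v - G y v z • w)
      + fderiv ℝ κ y v • (G y u z • w - G y w z • u)
      + fderiv ℝ κ y w • (G y v z • u - G y u z • v) = 0 := by
    intro u v w z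
    have hb := second_bianchi (hG.contDiffAt_chr hy) u v w z
    simp only [hfd, h y hy, hG.fderiv_eq hy, map_smul, map_sub] at hb
    rw [hG.chr_symm hy v u, hG.chr_symm hy w u, hG.chr_symm hy w v] at hb
    rw [← hb]
    module
  have hz : fderiv ℝ κ y = 0 := by
    ext u
    rcases eq_or_ne u 0 with rfl | hu
    · simp
    obtain ⟨v, hv, huv, -⟩ := hG.exists_unit_orthogonal hy hE u u
    obtain ⟨w, hw, huw, hvw⟩ := hG.exists_unit_orthogonal hy hE u v
    have hk := congrArg (fun x => G y x v) (key u v w w)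
    simpa [hw, huw, hvw, hv, huv, hG.symm y hy w v] using hk
  rw [← hz]
  exact hdiff.hasFDerivAt

end IsMetricOn

section ChangeOfCoordinates

variable {E : Type*} [NormedAddCommGroup E] [NormedSpace ℝ E]

theorem curv_eq_fderiv {Γ : E → E →L[ℝ] E →L[ℝ] E} {y : E} (hΓ : DifferentiableAt ℝ Γ y)
    (u v w : E) : curv Γ y u v w = fderiv ℝ (fun z => Γ z v w) y u - fderiv ℝ (fun z => Γ z u w) y v
      + Γ y u (Γ y v w) - Γ y v (Γ y u w) := by
  rw [fderiv_clm_apply₂_apply hΓ (differentiableAt_const _) (differentiableAt_const _),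
    fderiv_clm_apply₂_apply hΓ (differentiableAt_const _) (differentiableAt_const _)]
  simp [curv_apply_apply]

/-! ### Change of coordinates -/

/-- The smooth map `φ`, from the open set `s'` to the open set `s` of the same vector space, pulls
the metric `G` back to the metric `G'`. It need not be injective. -/
structure IsIsometryOn (φ : E → E) (G' : E → E →L[ℝ] E →L[ℝ] ℝ) (s' : Set E)
    (G : E → E →L[ℝ] E →L[ℝ] ℝ) (s : Set E) : Prop where
  source : IsMetricOn G' s'
  target : IsMetricOn G s
  mapsTo : MapsTo φ s' s
  contDiffAt : ∀ z ∈ s', ContDiffAt ℝ ∞ φ z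
  pullback : ∀ z ∈ s', ∀ u v, G' z u v = G (φ z) (fderiv ℝ φ z u) (fderiv ℝ φ z v)

namespace IsIsometryOn

variable {φ : E → E} {G G' : E → E →L[ℝ] E →L[ℝ] ℝ} {s s' : Set E} {y : E}

theorem fderiv_comp {F : Type*} [NormedAddCommGroup F] [NormedSpace ℝ F] {H : E → F}
    (hH : DifferentiableAt ℝ H (φ y)) (hφ : ContDiffAt ℝ ∞ φ y) (u : E) :
    fderiv ℝ (fun z => H (φ z)) y u = fderiv ℝ H (φ y) (fderiv ℝ φ y u) := by
  have := fderiv_fun_comp (x := y) hH hφ.differentiableAt_of_smooth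
  rw [this]; rfl

variable (h : IsIsometryOn φ G' s' G s)
include h

theorem surjective [FiniteDimensional ℝ E] (hy : y ∈ s') :
    Function.Surjective (fderiv ℝ φ y) := by
  have hi : Function.Injective (fderiv ℝ φ y : E →ₗ[ℝ] E) := by
    rw [← LinearMap.ker_eq_bot, LinearMap.ker_eq_bot']
    intro u hu
    by_contra h0
    have := h.source.pos y hy u h0
    rw [h.pullback y hy] at this
    simp only [ContinuousLinearMap.coe_coe] at hu
    simp [hu] at this
  exact LinearMap.injective_iff_surjective.1 hi

theorem fderiv_metric (hy : y ∈ s') (u v w : E) :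
    fderiv ℝ G' y u v w =
      fderiv ℝ G (φ y) (fderiv ℝ φ y u) (fderiv ℝ φ y v) (fderiv ℝ φ y w)
      + G (φ y) (fderiv ℝ (fderiv ℝ φ) y u v) (fderiv ℝ φ y w)
      + G (φ y) (fderiv ℝ φ y v) (fderiv ℝ (fderiv ℝ φ) y u w) := by
  have hφ := h.contDiffAt y hy
  have hd := hφ.fderiv_smooth.differentiableAt_of_smooth
  have hGd := h.target.differentiableAt (h.mapsTo hy)
  have hc : ∀ a : E, DifferentiableAt ℝ (fun _ : E => a) y := fun a => differentiableAt_const a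
  have he : (fun z => G' z v w) =ᶠ[𝓝 y] fun z => G (φ z) (fderiv ℝ φ z v) (fderiv ℝ φ z w) := by
    filter_upwards [h.source.isOpen.mem_nhds hy] with z hz using h.pullback z hz v w
  have h1 := DFunLike.congr_fun (he.fderiv_eq (𝕜 := ℝ)) u
  rw [fderiv_clm_apply₂_apply (h.source.differentiableAt hy) (hc v) (hc w),
    fderiv_clm_apply₂_apply (H := fun z => G (φ z)) (hGd.fun_comp' y hφ.differentiableAt_of_smooth)
      (hd.clm_apply (hc v)) (hd.clm_apply (hc w)), fderiv_comp hGd hφ,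
    fderiv_clm_apply_apply hd (hc v), fderiv_clm_apply_apply hd (hc w)] at h1
  simpa using h1

variable [FiniteDimensional ℝ E]

/-- The transformation law of the Christoffel symbols. -/
theorem fderiv_chr (hy : y ∈ s') (u v : E) :
    fderiv ℝ φ y (chr G' y u v) =
      fderiv ℝ (fderiv ℝ φ) y u v + chr G (φ y) (fderiv ℝ φ y u) (fderiv ℝ φ y v) := by
  have hφ := h.contDiffAt y hy
  refine h.target.ext (h.mapsTo hy) fun w' => ?_
  obtain ⟨w, rfl⟩ := h.surjective hy w'
  rw [← h.pullback y hy, h.source.apply_chr hy, map_add, add_apply,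
    h.target.apply_chr (h.mapsTo hy), h.fderiv_metric hy, h.fderiv_metric hy, h.fderiv_metric hy,
    hφ.snd_fderiv_symm v u, hφ.snd_fderiv_symm w u, hφ.snd_fderiv_symm w v,
    h.target.symm _ (h.mapsTo hy) (fderiv ℝ φ y v),
    h.target.symm _ (h.mapsTo hy) (fderiv ℝ φ y u)]
  ring

/-- The curvature tensor is natural under isometries. -/
theorem fderiv_curv (hy : y ∈ s') (u v w : E) :
    fderiv ℝ φ y (curv (chr G') y u v w) =
      curv (chr G) (φ y) (fderiv ℝ φ y u) (fderiv ℝ φ y v) (fderiv ℝ φ y w) := by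
  have hφ := h.contDiffAt y hy
  have h1 := hφ.fderiv_smooth.differentiableAt_of_smooth
  have h2 := hφ.fderiv_smooth.fderiv_smooth.differentiableAt_of_smooth
  have hc : ∀ a : E, DifferentiableAt ℝ (fun _ : E => a) y := fun a => differentiableAt_const a
  have hΓ' := h.source.differentiableAt_chr hy
  have hΓ := h.target.differentiableAt_chr (h.mapsTo hy)
  have key : ∀ a b : E,
      fderiv ℝ (fderiv ℝ φ) y a (chr G' y b w) + fderiv ℝ φ y (fderiv ℝ (chr G') y a b w) =
      fderiv ℝ (fderiv ℝ (fderiv ℝ φ)) y a b w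
      + fderiv ℝ (chr G) (φ y) (fderiv ℝ φ y a) (fderiv ℝ φ y b) (fderiv ℝ φ y w)
      + chr G (φ y) (fderiv ℝ (fderiv ℝ φ) y a b) (fderiv ℝ φ y w)
      + chr G (φ y) (fderiv ℝ φ y b) (fderiv ℝ (fderiv ℝ φ) y a w) := by
    intro a b
    have he : (fun z => fderiv ℝ φ z (chr G' z b w)) =ᶠ[𝓝 y] fun z =>
        fderiv ℝ (fderiv ℝ φ) z b w + chr G (φ z) (fderiv ℝ φ z b) (fderiv ℝ φ z w) := by
      filter_upwards [h.source.isOpen.mem_nhds hy] with z hz using h.fderiv_chr hz b w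
    have h3 := DFunLike.congr_fun (he.fderiv_eq (𝕜 := ℝ)) a
    have hcomp : DifferentiableAt ℝ (fun z => chr G (φ z)) y :=
      hΓ.fun_comp' y hφ.differentiableAt_of_smooth
    rw [fderiv_clm_apply_apply h1 ((hΓ'.clm_apply (hc b)).clm_apply (hc w)),
      fderiv_clm_apply₂_apply hΓ' (hc b) (hc w),
      fderiv_fun_add ((h2.clm_apply (hc b)).clm_apply (hc w))
        ((hcomp.clm_apply (h1.clm_apply (hc b))).clm_apply (h1.clm_apply (hc w))),
      add_apply, fderiv_clm_apply₂_apply h2 (hc b) (hc w),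
      fderiv_clm_apply₂_apply hcomp (h1.clm_apply (hc b)) (h1.clm_apply (hc w)),
      fderiv_comp hΓ hφ, fderiv_clm_apply_apply h1 (hc b), fderiv_clm_apply_apply h1 (hc w)] at h3
    simpa [add_assoc] using h3
  have k1 := key u v
  have k2 := key v u
  rw [hφ.fderiv_smooth.snd_fderiv_symm v u, hφ.snd_fderiv_symm v u] at k2
  rw [curv_apply_apply, curv_apply_apply]
  simp only [map_add, map_sub, h.fderiv_chr hy]
  rw [← eq_sub_iff_add_eq'] at k1 k2
  rw [k1, k2]
  abel

omit [FiniteDimensional ℝ E] in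
/-- The Lie derivative of the metric is natural under isometries. -/
theorem coordLieDeriv_eq {X X' : E → E} (hy : y ∈ s') (hX' : DifferentiableAt ℝ X' y)
    (hX : DifferentiableAt ℝ X (φ y)) (hXX' : ∀ z ∈ s', fderiv ℝ φ z (X' z) = X (φ z)) (u v : E) :
    coordLieDeriv G' X' y u v =
      coordLieDeriv G X (φ y) (fderiv ℝ φ y u) (fderiv ℝ φ y v) := by
  have hφ := h.contDiffAt y hy
  have h1 := hφ.fderiv_smooth.differentiableAt_of_smooth
  have key : ∀ a, fderiv ℝ X (φ y) (fderiv ℝ φ y a) =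
      fderiv ℝ (fderiv ℝ φ) y (X' y) a + fderiv ℝ φ y (fderiv ℝ X' y a) := by
    intro a
    have he : (fun z => fderiv ℝ φ z (X' z)) =ᶠ[𝓝 y] fun z => X (φ z) := by
      filter_upwards [h.source.isOpen.mem_nhds hy] with z hz using hXX' z hz
    have h3 := DFunLike.congr_fun (he.fderiv_eq (𝕜 := ℝ)) a
    rw [fderiv_comp hX hφ, fderiv_clm_apply_apply h1 hX', hφ.snd_fderiv_symm] at h3
    exact h3.symm
  simp only [coordLieDeriv]
  rw [key, key, h.fderiv_metric hy, h.pullback y hy, h.pullback y hy, hXX' y hy, map_add, map_add,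
    add_apply]
  ring

end IsIsometryOn

/-! ### Conformal change of the metric -/

namespace IsMetricOn

variable [FiniteDimensional ℝ E]
variable {G : E → E →L[ℝ] E →L[ℝ] ℝ} {s : Set E} {y : E} {f : E → ℝ}

omit [FiniteDimensional ℝ E] in
theorem conformal (hG : IsMetricOn G s) (hf : ContDiffOn ℝ ∞ f s) :
    IsMetricOn (fun z => Real.exp (-2 * f z) • G z) s where
  isOpen := hG.isOpen
  contDiffOn := (Real.contDiff_exp.comp_contDiffOn (contDiffOn_const.mul hf)).smul hG.contDiffOn
  symm y hy u v := by simp [hG.symm y hy u v]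
  pos y hy u hu := by simpa using mul_pos (Real.exp_pos _) (hG.pos y hy u hu)

/-- The gradient of `f` with respect to `G`, in coordinates: `G(grad f, ·) = df`. -/
def _root_.WeightedSec.coordGrad (G : E → E →L[ℝ] E →L[ℝ] ℝ) (f : E → ℝ) (y : E) : E :=
  (G y).inverse (fderiv ℝ f y)

theorem apply_coordGrad (hG : IsMetricOn G s) (hy : y ∈ s) (v : E) :
    G y (coordGrad G f y) v = fderiv ℝ f y v := by
  rw [coordGrad, hG.apply_inverse hy]

theorem contDiffAt_coordGrad (hG : IsMetricOn G s) (hf : ContDiffOn ℝ ∞ f s) (hy : y ∈ s) :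
    ContDiffAt ℝ ∞ (coordGrad G f) y :=
  (hG.contDiffAt_inverse hy).clm_apply
    (hf.contDiffAt (hG.isOpen.mem_nhds hy)).fderiv_smooth

theorem chr_conformal (hG : IsMetricOn G s) (hf : ContDiffOn ℝ ∞ f s) (hy : y ∈ s) (u v : E) :
    chr (fun z => Real.exp (-2 * f z) • G z) y u v =
      chr G y u v - fderiv ℝ f y u • v - fderiv ℝ f y v • u + G y u v • coordGrad G f y := by
  have hG' := hG.conformal hf
  have hfd : DifferentiableAt ℝ f y :=
    (hf.contDiffAt (hG.isOpen.mem_nhds hy)).differentiableAt_of_smooth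
  have hD : ∀ a b c, fderiv ℝ (fun z => Real.exp (-2 * f z) • G z) y a b c =
      Real.exp (-2 * f y) * (fderiv ℝ G y a b c - 2 * fderiv ℝ f y a * G y b c) := by
    intro a b c
    rw [fderiv_fun_smul (hfd.const_mul _).exp (hG.differentiableAt hy),
      fderiv_exp (hfd.const_mul _), fderiv_const_mul hfd]
    simp
    ring
  refine hG'.ext hy fun w => ?_
  rw [hG'.apply_chr hy, hD, hD, hD]
  simp only [smul_apply, map_add, map_sub, map_smul, add_apply, sub_apply, smul_eq_mul,
    hG.apply_chr hy, hG.apply_coordGrad hy]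
  rw [hG.symm y hy v w, hG.symm y hy u w]
  ring

/-- The Hessian `∇df` of `f` with respect to the Levi-Civita connection of `G`, in coordinates. -/
def _root_.WeightedSec.coordHess (G : E → E →L[ℝ] E →L[ℝ] ℝ) (f : E → ℝ) (y u v : E) : ℝ :=
  fderiv ℝ (fderiv ℝ f) y u v - fderiv ℝ f y (chr G y u v)

theorem fderiv_coordGrad (hG : IsMetricOn G s) (hf : ContDiffOn ℝ ∞ f s) (hy : y ∈ s) (u v : E) :
    G y (fderiv ℝ (coordGrad G f) y u) v =
      coordHess G f y u v - G y (chr G y u (coordGrad G f y)) v := by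
  have hc : DifferentiableAt ℝ (fun _ : E => v) y := differentiableAt_const v
  have he : (fun z => G z (coordGrad G f z) v) =ᶠ[𝓝 y] fun z => fderiv ℝ f z v := by
    filter_upwards [hG.isOpen.mem_nhds hy] with z hz using hG.apply_coordGrad hz v
  have h1 := DFunLike.congr_fun (he.fderiv_eq (𝕜 := ℝ)) u
  rw [fderiv_clm_apply₂_apply (hG.differentiableAt hy)
      (hG.contDiffAt_coordGrad hf hy).differentiableAt_of_smooth hc,
    fderiv_clm_apply_apply (hf.contDiffAt (hG.isOpen.mem_nhds
      hy)).fderiv_smooth.differentiableAt_of_smooth hc, hG.fderiv_eq hy,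
    hG.apply_coordGrad hy (chr G y u v)] at h1
  simp only [fderiv_fun_const, Pi.zero_apply, zero_apply, map_zero, add_zero] at h1
  rw [coordHess]
  linarith

theorem coordLieDeriv_eq (hG : IsMetricOn G s) (hy : y ∈ s) (X : E → E) (u v : E) :
    coordLieDeriv G X y u v = G y (fderiv ℝ X y u + chr G y u (X y)) v
      + G y u (fderiv ℝ X y v + chr G y v (X y)) := by
  rw [coordLieDeriv, hG.fderiv_eq hy, hG.chr_symm hy (X y), hG.chr_symm hy (X y)]
  simp only [map_add, add_apply]
  ring

omit [FiniteDimensional ℝ E] in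
theorem coordLieDeriv_symm (hG : IsMetricOn G s) (hy : y ∈ s) (X : E → E) (u v : E) :
    coordLieDeriv G X y u v = coordLieDeriv G X y v u := by
  rw [coordLieDeriv, coordLieDeriv, hG.fderiv_symm hy, hG.symm y hy u, hG.symm y hy _ v]
  ring

theorem coordHess_symm (hG : IsMetricOn G s) (hf : ContDiffOn ℝ ∞ f s) (hy : y ∈ s) (u v : E) :
    coordHess G f y u v = coordHess G f y v u := by
  rw [coordHess, coordHess, hG.chr_symm hy,
    (hf.contDiffAt (hG.isOpen.mem_nhds hy)).snd_fderiv_symm]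

theorem coordLieDeriv_coordGrad (hG : IsMetricOn G s) (hf : ContDiffOn ℝ ∞ f s) (hy : y ∈ s)
    (u v : E) : coordLieDeriv G (coordGrad G f) y u v = 2 * coordHess G f y u v := by
  rw [hG.coordLieDeriv_eq hy, hG.symm y hy u, map_add, map_add, add_apply, add_apply,
    hG.fderiv_coordGrad hf hy, hG.fderiv_coordGrad hf hy, hG.coordHess_symm hf hy v u]
  ring

/-- The change of the curvature form of a `G`-orthonormal pair when the metric is multiplied by
`e^{-2f}`: `G(R̃(u, v)v, u)` is `sec(u, v)` plus the values of `Hess f + df ⊗ df` at `(u, u)` and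
`(v, v)`, minus `|df|²`. -/
theorem curv_conformal (hG : IsMetricOn G s) (hf : ContDiffOn ℝ ∞ f s) (hy : y ∈ s) {u v : E}
    (hu : G y u u = 1) (hv : G y v v = 1) (huv : G y u v = 0) :
    G y (curv (chr (fun z => Real.exp (-2 * f z) • G z)) y u v v) u =
      G y (curv (chr G) y u v v) u + coordHess G f y u u + coordHess G f y v v
        + fderiv ℝ f y u ^ 2 + fderiv ℝ f y v ^ 2 - fderiv ℝ f y (coordGrad G f y) := by
  have hG' := hG.conformal hf
  have hfs := hf.contDiffAt (hG.isOpen.mem_nhds hy)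
  have hfd := hfs.fderiv_smooth.differentiableAt_of_smooth
  have hN := (hG.contDiffAt_coordGrad hf hy).differentiableAt_of_smooth
  have hGd := hG.differentiableAt hy
  have hΓ := hG.differentiableAt_chr hy
  have hc : ∀ a : E, DifferentiableAt ℝ (fun _ : E => a) y := fun a => differentiableAt_const a
  have hvu : G y v u = 0 := by rw [hG.symm y hy, huv]
  have hd : ∀ a b c, fderiv ℝ (fun z => chr (fun z => Real.exp (-2 * f z) • G z) z b c) y a =
      fderiv ℝ (chr G) y a b c - fderiv ℝ (fderiv ℝ f) y a b • c - fderiv ℝ (fderiv ℝ f) y a c • b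
      + fderiv ℝ G y a b c • coordGrad G f y + G y b c • fderiv ℝ (coordGrad G f) y a := by
    intro a b c
    have he : (fun z => chr (fun z => Real.exp (-2 * f z) • G z) z b c) =ᶠ[𝓝 y] fun z =>
        chr G z b c - fderiv ℝ f z b • c - fderiv ℝ f z c • b + G z b c • coordGrad G f z := by
      filter_upwards [hG.isOpen.mem_nhds hy] with z hz using hG.chr_conformal hf hz b c
    have d1 : DifferentiableAt ℝ (fun z => chr G z b c) y := (hΓ.clm_apply (hc b)).clm_apply (hc c)
    have d2 : ∀ b c : E, DifferentiableAt ℝ (fun z => fderiv ℝ f z b • c) y := fun b c =>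
      (hfd.clm_apply (hc b)).smul_const c
    have d3 : DifferentiableAt ℝ (fun z => G z b c) y := (hGd.clm_apply (hc b)).clm_apply (hc c)
    have e2 : ∀ b c : E, fderiv ℝ (fun z => fderiv ℝ f z b • c) y a =
        fderiv ℝ (fderiv ℝ f) y a b • c := by
      intro b c
      rw [fderiv_smul_const (hfd.clm_apply (hc b))]
      simp [fderiv_clm_apply_apply hfd (hc b)]
    rw [he.fderiv_eq, fderiv_fun_add ((d1.fun_sub (d2 b c)).fun_sub (d2 c b)) (d3.fun_smul hN),
      fderiv_fun_sub (d1.fun_sub (d2 b c)) (d2 c b), fderiv_fun_sub d1 (d2 b c),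
      fderiv_fun_smul d3 hN]
    simp only [add_apply, sub_apply, smul_apply, e2, ContinuousLinearMap.smulRight_apply,
      fderiv_clm_apply₂_apply hΓ (hc b) (hc c), fderiv_clm_apply₂_apply hGd (hc b) (hc c),
      fderiv_fun_const, Pi.zero_apply, zero_apply, map_zero, add_zero]
    abel
  rw [curv_eq_fderiv (hG'.differentiableAt_chr hy), curv_apply_apply]
  simp only [hd, hG.chr_conformal hf hy]
  simp only [map_add, map_sub, map_smul, add_apply, sub_apply, smul_apply, smul_eq_mul,
    hG.fderiv_coordGrad hf hy, hG.apply_coordGrad hy, hu, hv, huv, hvu, hG.fderiv_eq hy,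
    coordHess, hG.chr_symm hy v u]
  rw [hG.symm y hy u (chr G y v v), hG.symm y hy u (coordGrad G f y), hG.apply_coordGrad hy]
  ring

end IsMetricOn

end ChangeOfCoordinates

/-! ### Homothetic fields on space forms -/

namespace IsMetricOn

variable {E : Type*} [NormedAddCommGroup E] [NormedSpace ℝ E] [FiniteDimensional ℝ E]
variable {G : E → E →L[ℝ] E →L[ℝ] ℝ} {s : Set E} {y : E} {X : E → E}

/-- The covariant derivative `u ↦ ∇_u X` of the vector field `X`. -/
def _root_.WeightedSec.covDeriv (G : E → E →L[ℝ] E →L[ℝ] ℝ) (X : E → E) (y : E) : E →L[ℝ] E :=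
  fderiv ℝ X y + (chr G y).flip (X y)

omit [FiniteDimensional ℝ E] in
theorem _root_.WeightedSec.covDeriv_apply (u : E) :
    covDeriv G X y u = fderiv ℝ X y u + chr G y u (X y) := rfl

theorem contDiffAt_covDeriv (hG : IsMetricOn G s) (hX : ContDiffOn ℝ ∞ X s) (hy : y ∈ s) :
    ContDiffAt ℝ ∞ (covDeriv G X) y := by
  have h := hX.contDiffAt (hG.isOpen.mem_nhds hy)
  have hf : ContDiffAt ℝ ∞ (fun z => (chr G z).flip) y :=
    (ContinuousLinearMap.flipₗᵢ ℝ E E E).contDiff.contDiffAt.comp y (hG.contDiffAt_chr hy)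
  exact h.fderiv_smooth.add (hf.clm_apply h)

/-- The Ricci identity for the second covariant derivative of `X`. -/
theorem ricci_identity (hG : IsMetricOn G s) (hX : ContDiffOn ℝ ∞ X s) (hy : y ∈ s) (u v : E) :
    (fderiv ℝ (covDeriv G X) y u v + chr G y u (covDeriv G X y v)) -
      (fderiv ℝ (covDeriv G X) y v u + chr G y v (covDeriv G X y u)) =
      curv (chr G) y u v (X y) := by
  have h := hX.contDiffAt (hG.isOpen.mem_nhds hy)
  have hd := h.fderiv_smooth.differentiableAt_of_smooth
  have hΓ := hG.differentiableAt_chr hy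
  have hc : ∀ a : E, DifferentiableAt ℝ (fun _ : E => a) y := fun a => differentiableAt_const a
  have hB : ∀ a b, fderiv ℝ (covDeriv G X) y a b =
      fderiv ℝ (fderiv ℝ X) y a b + fderiv ℝ (chr G) y a b (X y)
        + chr G y b (fderiv ℝ X y a) := by
    intro a b
    have e1 : fderiv ℝ (fun z => covDeriv G X z b) y a = fderiv ℝ (covDeriv G X) y a b := by
      rw [fderiv_clm_apply_apply (hG.contDiffAt_covDeriv hX hy).differentiableAt_of_smooth (hc b)]
      simp
    rw [← e1]
    simp only [covDeriv_apply]
    rw [fderiv_fun_add (hd.clm_apply (hc b))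
        ((hΓ.clm_apply (hc b)).clm_apply h.differentiableAt_of_smooth), add_apply,
      fderiv_clm_apply_apply hd (hc b),
      fderiv_clm_apply₂_apply hΓ (hc b) h.differentiableAt_of_smooth]
    simp [add_assoc]
  rw [hB, hB, h.snd_fderiv_symm v u, curv_apply_apply, covDeriv_apply, covDeriv_apply, map_add,
    map_add]
  abel

/-- The second covariant derivative of a homothetic field is given by the curvature. As for Killing
fields, the homothety equation makes `G(∇_w ∇X (u), v)` skew in `u, v`, the Ricci identity
prescribes its skew part in `w, u`, and the two together determine it. -/
theorem fderiv_covDeriv_of_homothetic (hG : IsMetricOn G s) (hX : ContDiffOn ℝ ∞ X s) {ρ c : ℝ}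
    (hR : ∀ z ∈ s, ∀ u v w, curv (chr G) z u v w = ρ • (G z v w • u - G z u w • v))
    (hL : ∀ z ∈ s, ∀ u v, coordLieDeriv G X z u v = c * G z u v) (hy : y ∈ s) (w u : E) :
    fderiv ℝ (covDeriv G X) y w u = ρ • (G y u (X y) • w - G y w u • X y)
      - chr G y w (covDeriv G X y u) + covDeriv G X y (chr G y w u) := by
  have hBd := (hG.contDiffAt_covDeriv hX hy).differentiableAt_of_smooth
  have hGd := hG.differentiableAt hy
  have hc : ∀ a : E, DifferentiableAt ℝ (fun _ : E => a) y := fun a => differentiableAt_const a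
  have hL' : ∀ z ∈ s, ∀ u v, G z (covDeriv G X z u) v + G z u (covDeriv G X z v) = c * G z u v := by
    intro z hz u v
    rw [← hL z hz, hG.coordLieDeriv_eq hz]
    rfl
  -- `T w u v = G (∇_w ∇X) u v` is skew in `u, v`, and its skew part in `w, u` is curvature
  obtain ⟨T, hT⟩ : ∃ T : E → E → E → ℝ, ∀ w u v, T w u v = G y (fderiv ℝ (covDeriv G X) y w u
    + chr G y w (covDeriv G X y u) - covDeriv G X y (chr G y w u)) v := ⟨_, fun _ _ _ => rfl⟩
  have skew : ∀ w u v, T w u v = - T w v u := by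
    intro w u v
    have he : (fun z => G z (covDeriv G X z u) v + G z u (covDeriv G X z v)) =ᶠ[𝓝 y]
        fun z => c * G z u v := by
      filter_upwards [hG.isOpen.mem_nhds hy] with z hz using hL' z hz u v
    have h1 := DFunLike.congr_fun (he.fderiv_eq (𝕜 := ℝ)) w
    rw [fderiv_fun_add ((hGd.clm_apply (hBd.clm_apply (hc u))).clm_apply (hc v))
      ((hGd.clm_apply (hc u)).clm_apply (hBd.clm_apply (hc v))), add_apply,
      fderiv_const_mul ((hGd.clm_apply (hc u)).clm_apply (hc v)), smul_apply,
      fderiv_clm_apply₂_apply hGd (hBd.clm_apply (hc u)) (hc v),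
      fderiv_clm_apply₂_apply hGd (hc u) (hBd.clm_apply (hc v)),
      fderiv_clm_apply₂_apply hGd (hc u) (hc v),
      fderiv_clm_apply_apply hBd (hc u), fderiv_clm_apply_apply hBd (hc v)] at h1
    simp only [fderiv_fun_const, Pi.zero_apply, zero_apply, map_zero, add_zero,
      smul_eq_mul, hG.fderiv_eq hy] at h1
    rw [hT, hT]
    simp only [map_add, map_sub, add_apply, sub_apply]
    rw [hG.symm y hy (fderiv ℝ (covDeriv G X) y w v) u, hG.symm y hy (chr G y w _) u,
      hG.symm y hy (covDeriv G X y (chr G y w v)) u]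
    have e1 := hL' y hy (chr G y w u) v
    have e2 := hL' y hy u (chr G y w v)
    linarith
  have ricci : ∀ w u v, T w u v - T u w v =
      ρ * (G y u (X y) * G y w v - G y w (X y) * G y u v) := by
    intro w u v
    have h1 := congrArg (fun x => G y x v) (hG.ricci_identity hX hy w u)
    rw [hT, hT, hG.chr_symm hy u w]
    simp only [hR y hy, map_add, map_sub, map_smul, add_apply, sub_apply, smul_apply,
      smul_eq_mul] at h1 ⊢
    linarith
  rw [← sub_eq_zero]
  refine hG.ext hy fun v => ?_
  have h1 := hT w u v
  simp only [map_add, map_sub, map_smul, add_apply, sub_apply, smul_apply, smul_eq_mul, map_zero,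
    zero_apply] at h1 ⊢
  have k1 := ricci w u v
  have k2 := ricci u v w
  have k3 := ricci v w u
  rw [hG.symm y hy v w] at k2
  rw [hG.symm y hy w u, hG.symm y hy v u] at k3
  rw [hG.symm y hy (X y) v, hG.symm y hy w u]
  rw [hG.symm y hy u v] at k1 k3
  linarith [skew w u v, skew u w v, skew v w u, skew w v u, skew u v w, skew v u w]

/-- A homothetic field on a space of constant nonzero curvature is a Killing field. By
`fderiv_covDeriv_of_homothetic` the covariant derivative of `∇X` is `ρ` times a term that is linear
in `X`. For an orthonormal pair `a, w`, commuting derivatives of `∇X` in the directions `a` and `w`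
compares the curvature with the symmetric part of `∇X`, and leaves `ρ * c = 0`. -/
theorem mul_eq_zero_of_homothetic (hG : IsMetricOn G s) (hX : ContDiffOn ℝ ∞ X s)
    (hE : 2 < Module.finrank ℝ E) {ρ c : ℝ}
    (hR : ∀ z ∈ s, ∀ u v w, curv (chr G) z u v w = ρ • (G z v w • u - G z u w • v))
    (hL : ∀ z ∈ s, ∀ u v, coordLieDeriv G X z u v = c * G z u v) (hy : y ∈ s) : ρ * c = 0 := by
  have hBs := hG.contDiffAt_covDeriv hX hy
  have hBd := hBs.differentiableAt_of_smooth
  have hBdd := hBs.fderiv_smooth.differentiableAt_of_smooth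
  have hXd := (hX.contDiffAt (hG.isOpen.mem_nhds hy)).differentiableAt_of_smooth
  have hGd := hG.differentiableAt hy
  have hΓ := hG.differentiableAt_chr hy
  have hc : ∀ a : E, DifferentiableAt ℝ (fun _ : E => a) y := fun a => differentiableAt_const a
  obtain ⟨a, ha, -, -⟩ := hG.exists_unit_orthogonal hy hE 0 0
  obtain ⟨w, hw, haw, -⟩ := hG.exists_unit_orthogonal hy hE a a
  have hwa : G y w a = 0 := by rw [hG.symm y hy, haw]
  -- differentiate the formula of `fderiv_covDeriv_of_homothetic` once more
  have key : ∀ a w u, fderiv ℝ (fderiv ℝ (covDeriv G X)) y a w u =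
      ρ • ((fderiv ℝ G y a u (X y) + G y u (fderiv ℝ X y a)) • w - (fderiv ℝ G y a w u • X y
        + G y w u • fderiv ℝ X y a))
      - (fderiv ℝ (chr G) y a w (covDeriv G X y u) + chr G y w (fderiv ℝ (covDeriv G X) y a u))
      + (fderiv ℝ (covDeriv G X) y a (chr G y w u)
        + covDeriv G X y (fderiv ℝ (chr G) y a w u)) := by
    intro a w u
    have he : (fun z => fderiv ℝ (covDeriv G X) z w u) =ᶠ[𝓝 y] fun z =>
        ρ • (G z u (X z) • w - G z w u • X z)
          - chr G z w (covDeriv G X z u) + covDeriv G X z (chr G z w u) := by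
      filter_upwards [hG.isOpen.mem_nhds hy] with z hz using
        hG.fderiv_covDeriv_of_homothetic hX hR hL hz w u
    have h1 := DFunLike.congr_fun (he.fderiv_eq (𝕜 := ℝ)) a
    have d1 : DifferentiableAt ℝ (fun z => G z u (X z)) y := (hGd.clm_apply (hc u)).clm_apply hXd
    have d2 : DifferentiableAt ℝ (fun z => G z w u) y := (hGd.clm_apply (hc w)).clm_apply (hc u)
    have d3 : DifferentiableAt ℝ (fun z => chr G z w (covDeriv G X z u)) y :=
      (hΓ.clm_apply (hc w)).clm_apply (hBd.clm_apply (hc u))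
    have d4 : DifferentiableAt ℝ (fun z => chr G z w u) y := (hΓ.clm_apply (hc w)).clm_apply (hc u)
    have d5 : DifferentiableAt ℝ (fun z => G z u (X z) • w - G z w u • X z) y :=
      (d1.smul_const w).fun_sub (d2.fun_smul hXd)
    rw [fderiv_fun_add ((d5.fun_const_smul ρ).fun_sub d3) (hBd.clm_apply d4),
      fderiv_fun_sub (d5.fun_const_smul ρ) d3, fderiv_fun_const_smul d5,
      fderiv_fun_sub (d1.smul_const w) (d2.fun_smul hXd), fderiv_smul_const d1,
      fderiv_fun_smul d2 hXd] at h1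
    simp only [add_apply, sub_apply, smul_apply, ContinuousLinearMap.smulRight_apply,
      fderiv_clm_apply₂_apply hGd (hc u) hXd, fderiv_clm_apply₂_apply hGd (hc w) (hc u),
      fderiv_clm_apply₂_apply hΓ (hc w) (hBd.clm_apply (hc u)),
      fderiv_clm_apply_apply hBd (hc u), fderiv_clm_apply_apply hBd d4,
      fderiv_clm_apply₂_apply hΓ (hc w) (hc u), fderiv_clm_apply₂_apply hBdd (hc w) (hc u),
      fderiv_fun_const, Pi.zero_apply, zero_apply, map_zero, add_zero] at h1
    rw [h1]
    abel_nf
  -- the equality of mixed derivatives, applied to `w` and paired with `a`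
  have h1 := hBs.snd_fderiv_symm a w
  have h2 := DFunLike.congr_fun h1 w
  rw [key, key] at h2
  have h3 := congrArg (fun x => G y x a) h2
  have hX' : ∀ b, fderiv ℝ X y b = covDeriv G X y b - chr G y b (X y) := by
    intro b; rw [covDeriv_apply]; abel
  have hR1 := congrArg (fun x => G y x a) (hR y hy a w (covDeriv G X y w))
  have hR2 := congrArg (fun x => G y (covDeriv G X y x) a) (hR y hy a w w)
  have hL1 := hL y hy w w
  rw [hG.coordLieDeriv_eq hy, ← covDeriv_apply] at hL1
  simp only [hX', hG.fderiv_covDeriv_of_homothetic hX hR hL hy, hG.fderiv_eq hy,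
    curv_apply_apply] at h3 hR1 hR2
  simp only [map_add, map_sub, map_smul, add_apply, sub_apply, smul_apply, smul_eq_mul,
    ha, hw, haw, hwa, hG.chr_symm hy w a] at h3 hR1 hR2 hL1
  rw [hG.symm y hy (covDeriv G X y w) w] at hL1
  linear_combination (-1 : ℝ) * h3 - hR1 + hR2 - ρ * hL1

end IsMetricOn

/-! ### Parallel coframes of a flat connection -/

section Flat

variable {E : Type*} [NormedAddCommGroup E] [NormedSpace ℝ E]

/-- A smooth map is, near each point, bounded and Lipschitz with bounded derivative, and is
approximated by its derivative with quadratic error, all with one constant. -/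
theorem exists_ball_bounds {F : Type*} [NormedAddCommGroup F] [NormedSpace ℝ F] {Γ : E → F}
    {s : Set E} (hs : IsOpen s) (hΓ : ContDiffOn ℝ ∞ Γ s) {y₀ : E} (hy₀ : y₀ ∈ s) :
    ∃ C : ℝ, 1 ≤ C ∧ ∃ r > 0, Metric.ball y₀ r ⊆ s ∧ ∀ a ∈ Metric.ball y₀ r,
      ‖Γ a‖ ≤ C ∧ ‖fderiv ℝ Γ a‖ ≤ C ∧ ∀ b ∈ Metric.ball y₀ r, ‖Γ b - Γ a‖ ≤ C * ‖b - a‖ ∧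
        ‖Γ b - Γ a - fderiv ℝ Γ a (b - a)‖ ≤ C * ‖b - a‖ ^ 2 := by
  have h0 := hΓ.contDiffAt (hs.mem_nhds hy₀)
  have h1 := h0.fderiv_smooth
  obtain ⟨K, t, ht, hK⟩ := (h1.of_le (m := 1) (by exact_mod_cast le_top)).exists_lipschitzOnWith
  have b0 : ∀ᶠ y in 𝓝 y₀, ‖Γ y‖ < ‖Γ y₀‖ + 1 :=
    h0.continuousAt.norm.eventually_lt continuousAt_const (by simp)
  have b1 : ∀ᶠ y in 𝓝 y₀, ‖fderiv ℝ Γ y‖ < ‖fderiv ℝ Γ y₀‖ + 1 :=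
    h1.continuousAt.norm.eventually_lt continuousAt_const (by simp)
  have bs : ∀ᶠ y in 𝓝 y₀, y ∈ s := hs.mem_nhds hy₀
  have bt : ∀ᶠ y in 𝓝 y₀, y ∈ t := ht
  obtain ⟨r, hr, hb⟩ := Metric.eventually_nhds_iff_ball.1
    ((bs.and bt).and (b0.and b1))
  have hd : ∀ z ∈ Metric.ball y₀ r, HasFDerivAt Γ (fderiv ℝ Γ z) z := fun z hz =>
    (hΓ.contDiffAt (hs.mem_nhds (hb z hz).1.1)).differentiableAt_of_smooth.hasFDerivAt
  set C : ℝ := ‖Γ y₀‖ + ‖fderiv ℝ Γ y₀‖ + K + 1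
  have hC1 : ‖fderiv ℝ Γ y₀‖ + 1 ≤ C := by
    have := norm_nonneg (Γ y₀); have := K.coe_nonneg; linarith
  have hC0 : ‖Γ y₀‖ + 1 ≤ C := by
    have := norm_nonneg (fderiv ℝ Γ y₀); have := K.coe_nonneg; linarith
  have hCK : (K : ℝ) ≤ C := by
    have := norm_nonneg (fderiv ℝ Γ y₀); have := norm_nonneg (Γ y₀); linarith
  refine ⟨C, by linarith [norm_nonneg (Γ y₀)], r, hr, fun y hy => (hb y hy).1.1, fun a ha =>
    ⟨((hb a ha).2.1.le).trans hC0, ((hb a ha).2.2.le).trans hC1, fun b hbb => ⟨?_, ?_⟩⟩⟩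
  · exact (convex_ball y₀ r).norm_image_sub_le_of_norm_hasFDerivWithin_le
      (fun z hz => (hd z hz).hasFDerivWithinAt) (fun z hz => ((hb z hz).2.2.le).trans hC1) ha hbb
  · have hsub : segment ℝ a b ⊆ Metric.ball y₀ r := (convex_ball y₀ r).segment_subset ha hbb
    have := (convex_segment a b).norm_image_sub_le_of_norm_hasFDerivWithin_le'
      (fun z hz => (hd z (hsub hz)).hasFDerivWithinAt) (φ := fderiv ℝ Γ a) (C := C * ‖b - a‖)
      (fun z hz => ?_) (left_mem_segment ℝ a b) (right_mem_segment ℝ a b)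
    · calc _ ≤ _ := this
        _ = _ := by ring
    · have hl := hK.norm_sub_le (hb z (hsub hz)).1.2 (hb a ha).1.2
      have hz' : ‖z - a‖ ≤ ‖b - a‖ := by
        obtain ⟨θ, hθ, rfl⟩ := (segment_eq_image' ℝ a b ▸ hz :)
        simp only [add_sub_cancel_left, norm_smul, Real.norm_eq_abs, abs_of_nonneg hθ.1]
        exact mul_le_of_le_one_left (norm_nonneg _) hθ.2
      calc _ ≤ _ := hl
        _ ≤ C * ‖b - a‖ := by gcongr

/-- The linear equation `p' = a(t) p` is solvable on the unit interval, if `a` is so small that the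
solution stays within distance one of its initial value. -/
theorem exists_transport {F : Type*} [NormedAddCommGroup F] [NormedSpace ℝ F] [CompleteSpace F]
    {a : ℝ → F →L[ℝ] F} (ha : ContinuousOn a (Icc 0 1)) (p₀ : F) (r : ℝ)
    (hr : (‖p₀‖ + 1) * r ≤ 1) (hbound : ∀ t ∈ Icc (0 : ℝ) 1, ‖a t‖ ≤ r) :
    ∃ p : ℝ → F, p 0 = p₀ ∧ ∀ t ∈ Icc (0 : ℝ) 1, HasDerivWithinAt p (a t (p t)) (Icc 0 1) t := by
  have hr0 : 0 ≤ r := (norm_nonneg _).trans (hbound 0 (by simp))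
  have hpl : IsPicardLindelof (fun t p => a t p) (tmin := 0) (tmax := 1)
      ⟨0, by simp⟩ p₀ 1 0 1 ⟨r, hr0⟩ := by
    refine ⟨fun t ht => ?_, fun x _ => ha.clm_apply continuousOn_const,
      fun t ht x hx => ?_, by simp⟩
    · refine LipschitzOnWith.of_dist_le_mul fun x _ y _ => ?_
      rw [dist_eq_norm, ← map_sub, dist_eq_norm]
      exact (a t).le_of_opNorm_le (hbound t ht) _
    · have hx' : ‖x‖ ≤ ‖p₀‖ + 1 := by
        have : ‖x - p₀‖ ≤ 1 := by simpa [dist_eq_norm] using hx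
        linarith [norm_le_norm_add_norm_sub' x p₀]
      calc _ ≤ r * ‖x‖ := (a t).le_of_opNorm_le (hbound t ht) _
        _ ≤ r * (‖p₀‖ + 1) := by gcongr
        _ ≤ _ := by rw [mul_comm]; simpa using hr
  simpa using hpl.exists_eq_forall_mem_Icc_hasDerivWithinAt₀

/-- Let `p` be the transport along the ray in the direction `x`, so `p' = p ∘ Γ_x`. Then
`p (1 + t Γ_h)` satisfies the transport equation `q' = q ∘ Γ_{x + h}` of the neighbouring ray up to
an error quadratic in `h`: here `y` and `z` are the points of the two rays at time `t`, and flatness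
cancels the terms linear in `h`. -/
theorem norm_transport_error_le {Γ : E → E →L[ℝ] E →L[ℝ] E} {C : ℝ} (hC : 1 ≤ C) {y z x h : E}
    {t : ℝ} (ht : t ∈ Icc (0 : ℝ) 1) (hx : ‖x + h‖ ≤ 1) (hz : z - y = t • h)
    (hflat : ∀ u v, curv Γ y u v = 0) (h0 : ‖Γ y‖ ≤ C) (h1 : ‖fderiv ℝ Γ y‖ ≤ C)
    (h2 : ‖Γ z - Γ y‖ ≤ C * ‖z - y‖)
    (h3 : ‖Γ z - Γ y - fderiv ℝ Γ y (z - y)‖ ≤ C * ‖z - y‖ ^ 2) :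
    ‖Γ y x + t • (Γ y x ∘L Γ y h) + (Γ y h + t • fderiv ℝ Γ y x h)
      - (Γ z (x + h) + t • (Γ y h ∘L Γ z (x + h)))‖ ≤ 4 * C ^ 2 * ‖h‖ ^ 2 := by
  have hC0 : 0 ≤ C := by linarith
  have ht0 : ‖t‖ ≤ 1 := by rw [Real.norm_eq_abs, abs_of_nonneg ht.1]; exact ht.2
  have hzy : ‖z - y‖ ≤ ‖h‖ := by
    rw [hz, norm_smul]; exact mul_le_of_le_one_left (norm_nonneg _) ht0
  obtain ⟨Δ, hΔ⟩ : ∃ Δ, Δ = Γ z - Γ y - fderiv ℝ Γ y (z - y) := ⟨_, rfl⟩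
  have hcurv := hflat x h
  rw [curv_apply] at hcurv
  have hexp : Γ y x + t • (Γ y x ∘L Γ y h) + (Γ y h + t • fderiv ℝ Γ y x h)
      - (Γ z (x + h) + t • (Γ y h ∘L Γ z (x + h))) =
      -(t • fderiv ℝ Γ y h h + Δ (x + h) + t • (Γ y h ∘L ((Γ z - Γ y) (x + h) + Γ y h))) := by
    have hΓz : Γ z (x + h) = Γ y (x + h) + t • fderiv ℝ Γ y h (x + h) + Δ (x + h) := by
      rw [hΔ, hz]; simp
    have e : Γ y h ∘L ((Γ z - Γ y) (x + h) + Γ y h) = Γ y h ∘L Γ z (x + h) - Γ y h ∘L Γ y x := by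
      rw [← ContinuousLinearMap.comp_sub]; congr 1; simp; abel
    rw [e, hΓz, ← sub_eq_zero]
    simp only [map_add]
    rw [← smul_zero t, ← hcurv]
    module
  have n1 : ‖t • fderiv ℝ Γ y h h‖ ≤ C * ‖h‖ ^ 2 := by
    rw [norm_smul]
    calc ‖t‖ * ‖fderiv ℝ Γ y h h‖ ≤ 1 * (C * ‖h‖ * ‖h‖) := by
          gcongr
          exact (fderiv ℝ Γ y h).le_of_opNorm_le ((fderiv ℝ Γ y).le_of_opNorm_le h1 h) h
      _ = _ := by ring
  have n2 : ‖Δ (x + h)‖ ≤ C * ‖h‖ ^ 2 := by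
    have hΔn : ‖Δ‖ ≤ C * ‖h‖ ^ 2 := by
      rw [hΔ]; exact h3.trans (by gcongr)
    calc ‖Δ (x + h)‖ ≤ C * ‖h‖ ^ 2 * ‖x + h‖ := Δ.le_of_opNorm_le hΔn _
      _ ≤ C * ‖h‖ ^ 2 * 1 := by gcongr
      _ = _ := by ring
  have n4 : ‖Γ y h‖ ≤ C * ‖h‖ := (Γ y).le_of_opNorm_le h0 h
  have n3 : ‖t • (Γ y h ∘L ((Γ z - Γ y) (x + h) + Γ y h))‖ ≤ 2 * C ^ 2 * ‖h‖ ^ 2 := by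
    rw [norm_smul]
    have n5 : ‖(Γ z - Γ y) (x + h)‖ ≤ C * ‖h‖ := by
      calc ‖(Γ z - Γ y) (x + h)‖ ≤ C * ‖h‖ * ‖x + h‖ :=
            (Γ z - Γ y).le_of_opNorm_le (h2.trans (by gcongr)) _
        _ ≤ C * ‖h‖ * 1 := by gcongr
        _ = _ := by ring
    calc _ ≤ 1 * ((C * ‖h‖) * (C * ‖h‖ + C * ‖h‖)) := by
          gcongr
          refine (ContinuousLinearMap.opNorm_comp_le _ _).trans ?_
          gcongr
          exact (norm_add_le _ _).trans (add_le_add n5 n4)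
      _ = _ := by ring
  rw [hexp, norm_neg]
  calc _ ≤ C * ‖h‖ ^ 2 + C * ‖h‖ ^ 2 + 2 * C ^ 2 * ‖h‖ ^ 2 :=
        (norm_add_le _ _).trans (add_le_add ((norm_add_le _ _).trans (add_le_add n1 n2)) n3)
    _ ≤ _ := by nlinarith [sq_nonneg ‖h‖, mul_nonneg (sub_nonneg.2 hC) hC0]

variable [CompleteSpace E]

/-- A flat connection has a parallel coframe with any prescribed value at a point. It is obtained by
transport along rays; `norm_transport_error_le` and Grönwall's inequality show that the result is
differentiable, with the required derivative. -/
theorem exists_parallel_coframe {Γ : E → E →L[ℝ] E →L[ℝ] E} {s : Set E} (hs : IsOpen s)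
    (hΓ : ContDiffOn ℝ ∞ Γ s) (hflat : ∀ y ∈ s, ∀ u v, curv Γ y u v = 0) {y₀ : E} (hy₀ : y₀ ∈ s)
    (P₀ : E →L[ℝ] E) :
    ∃ r > 0, Metric.ball y₀ r ⊆ s ∧ ∃ P : E → E →L[ℝ] E, P y₀ = P₀ ∧ ∀ y ∈ Metric.ball y₀ r,
      HasFDerivAt P (ContinuousLinearMap.compL ℝ E E E (P y) ∘L Γ y) y := by
  obtain ⟨C, hC, r₀, hr₀, hsub, hb⟩ := exists_ball_bounds hs hΓ hy₀
  have hCpos : 0 < C := by linarith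
  -- the radius is so small that the transport equation has a solution up to time one
  obtain ⟨r, hr, hr1, hr2, hr3⟩ : ∃ r > 0, r ≤ r₀ ∧ r ≤ 1 ∧ (‖P₀‖ + 1) * (C * r) ≤ 1 := by
    have hM : 0 < (‖P₀‖ + 1) * C := by positivity
    refine ⟨min r₀ (min 1 (1 / ((‖P₀‖ + 1) * C))), by positivity, min_le_left _ _,
      (min_le_right _ _).trans (min_le_left _ _), ?_⟩
    rw [← mul_assoc, ← le_div_iff₀' hM]
    exact (min_le_right _ _).trans (min_le_right _ _)
  have hCr : C * r ≤ 1 := by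
    have : 0 ≤ C * r := by positivity
    nlinarith [norm_nonneg P₀]
  have hmem : ∀ x : E, ‖x‖ < r → ∀ t ∈ Icc (0 : ℝ) 1, y₀ + t • x ∈ Metric.ball y₀ r₀ := by
    intro x hx t ht
    rw [mem_ball_iff_norm, add_sub_cancel_left, norm_smul, Real.norm_eq_abs, abs_of_nonneg ht.1]
    calc t * ‖x‖ ≤ 1 * ‖x‖ := by gcongr; exact ht.2
      _ < r₀ := by linarith
  have hray : ∀ (x : E) (t : ℝ), HasDerivAt (fun t : ℝ => y₀ + t • x) x t := fun x t => by
    simpa using ((hasDerivAt_id t).smul_const x).const_add y₀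
  have hΓd : ∀ y ∈ Metric.ball y₀ r₀, HasFDerivAt Γ (fderiv ℝ Γ y) y := fun y hy =>
    (hΓ.contDiffAt (hs.mem_nhds (hsub hy))).differentiableAt_of_smooth.hasFDerivAt
  have hbd : ∀ x : E, ‖x‖ < r → ∀ t ∈ Icc (0 : ℝ) 1, ‖Γ (y₀ + t • x) x‖ ≤ C * r := by
    intro x hx t ht
    calc _ ≤ C * ‖x‖ := (Γ _).le_of_opNorm_le (hb _ (hmem x hx t ht)).1 x
      _ ≤ C * r := by gcongr
  have hflip : ∀ A : E →L[ℝ] E, ‖(ContinuousLinearMap.compL ℝ E E E).flip A‖ ≤ ‖A‖ := by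
    intro A
    refine ContinuousLinearMap.opNorm_le_bound _ (norm_nonneg _) fun Q => ?_
    rw [mul_comm]
    exact ContinuousLinearMap.opNorm_comp_le Q A
  have hex : ∀ x : E, ∃ p : ℝ → E →L[ℝ] E, ‖x‖ < r → p 0 = P₀ ∧ ∀ t ∈ Icc (0 : ℝ) 1,
      HasDerivWithinAt p (p t ∘L Γ (y₀ + t • x) x) (Icc 0 1) t := by
    intro x
    by_cases hx : ‖x‖ < r
    · have hcont : ContinuousOn
          (fun t : ℝ => (ContinuousLinearMap.compL ℝ E E E).flip (Γ (y₀ + t • x) x)) (Icc 0 1) := by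
        refine (ContinuousLinearMap.continuous _).comp_continuousOn (ContinuousOn.clm_apply ?_
          continuousOn_const)
        intro t ht
        exact ((hΓd _ (hmem x hx t ht)).continuousAt.comp
          (f := fun t : ℝ => y₀ + t • x) (hray x t).continuousAt).continuousWithinAt
      obtain ⟨p, hp⟩ := exists_transport hcont P₀ (C * r) hr3
        (fun t ht => (hflip _).trans (hbd x hx t ht))
      exact ⟨p, fun _ => hp⟩
    · exact ⟨0, fun h => absurd h hx⟩
  choose p hp using hex
  have hright : ∀ x, ‖x‖ < r → ∀ t ∈ Ico (0 : ℝ) 1,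
      HasDerivWithinAt (p x) (p x t ∘L Γ (y₀ + t • x) x) (Ici t) t := fun x hx t ht =>
    ((hp x hx).2 t (Ico_subset_Icc_self ht)).mono_of_mem_nhdsWithin (Icc_mem_nhdsGE_of_mem ht)
  have hpc : ∀ x, ‖x‖ < r → ContinuousOn (p x) (Icc 0 1) := fun x hx t ht =>
    ((hp x hx).2 t ht).continuousWithinAt
  obtain ⟨M, hM0, hM⟩ : ∃ M, 0 ≤ M ∧ ∀ x, ‖x‖ < r → ∀ t ∈ Icc (0 : ℝ) 1, ‖p x t‖ ≤ M := by
    refine ⟨‖P₀‖ * Real.exp 1, by positivity, fun x hx t ht => ?_⟩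
    have := norm_le_gronwallBound_of_norm_deriv_right_le (δ := ‖P₀‖) (K := 1) (ε := 0)
      (hpc x hx) (hright x hx) (by rw [(hp x hx).1]) (fun t ht => by
        rw [add_zero, one_mul]
        refine (ContinuousLinearMap.opNorm_comp_le _ _).trans ?_
        exact mul_le_of_le_one_right (norm_nonneg _)
          ((hbd x hx t (Ico_subset_Icc_self ht)).trans hCr)) t ht
    rw [gronwallBound_ε0] at this
    refine this.trans ?_
    gcongr
    linarith [ht.2]
  refine ⟨r, hr, (Metric.ball_subset_ball hr1).trans hsub, fun y => p (y - y₀) 1, ?_, ?_⟩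
  -- the transport along the constant ray is constant
  · have h0 : ‖(0 : E)‖ < r := by simpa using hr
    have := constant_of_has_deriv_right_zero (hpc 0 h0) (fun t ht => by
      simpa using hright 0 h0 t ht) 1 (by simp)
    simpa [(hp 0 h0).1] using this
  intro y hy
  obtain ⟨x, rfl⟩ : ∃ x, y = y₀ + x := ⟨y - y₀, by abel⟩
  have hx : ‖x‖ < r := by simpa [mem_ball_iff_norm] using hy
  -- quadratic estimate for the deviation from the expected derivative; `8` bounds `4 (e - 1)`
  have main : ∀ h : E, ‖x + h‖ < r →
      ‖p (x + h) 1 - p x 1 - p x 1 ∘L Γ (y₀ + x) h‖ ≤ 8 * M * C ^ 2 * ‖h‖ ^ 2 := by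
    intro h hxh
    have hfd : ∀ t ∈ Icc (0 : ℝ) 1, HasDerivWithinAt
        (fun t => p x t + t • (p x t ∘L Γ (y₀ + t • x) h))
        (p x t ∘L (Γ (y₀ + t • x) x + t • (Γ (y₀ + t • x) x ∘L Γ (y₀ + t • x) h)
          + (Γ (y₀ + t • x) h + t • fderiv ℝ Γ (y₀ + t • x) x h))) (Icc 0 1) t := by
      intro t ht
      have d1 := (hp x hx).2 t ht
      have d2 : HasDerivWithinAt (fun t : ℝ => Γ (y₀ + t • x) h)
          (fderiv ℝ Γ (y₀ + t • x) x h) (Icc 0 1) t := by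
        have := ((hΓd _ (hmem x hx t ht)).comp_hasDerivAt_of_eq t (hray x t)
          rfl).clm_apply (hasDerivAt_const t h)
        simpa using this.hasDerivWithinAt
      have d3 := d1.add ((hasDerivWithinAt_id t (Icc 0 1)).smul (d1.clm_comp d2))
      refine d3.congr_deriv ?_
      ext v
      simp
      abel
    have hgr := dist_le_of_approx_trajectories_ODE_of_mem (K := 1) (s := fun _ => univ)
      (v := fun t q => q ∘L Γ (y₀ + t • (x + h)) (x + h)) (δ := 0) (εg := 0)
      (εf := M * (4 * C ^ 2 * ‖h‖ ^ 2))
      (fun t ht => ?_) (fun t ht => (hfd t ht).continuousWithinAt)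
      (fun t ht => (hfd t (Ico_subset_Icc_self ht)).mono_of_mem_nhdsWithin
        (Icc_mem_nhdsGE_of_mem ht))
      (fun t ht => ?_) (fun _ _ => mem_univ _) (hpc (x + h) hxh) (hright (x + h) hxh)
      (fun t ht => by simp) (fun _ _ => mem_univ _) (by simp [(hp x hx).1, (hp (x + h) hxh).1])
      1 (by simp)
    · rw [gronwallBound_of_K_ne_0 (by simp), dist_comm, dist_eq_norm] at hgr
      simp only [one_smul, add_zero, zero_mul, NNReal.coe_one, div_one, one_mul, sub_zero,
        zero_add] at hgr
      rw [← sub_sub] at hgr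
      refine hgr.trans ?_
      have he : Real.exp 1 - 1 ≤ 2 := by linarith [Real.exp_one_lt_d9]
      calc _ ≤ M * (4 * C ^ 2 * ‖h‖ ^ 2) * 2 := by gcongr
        _ = _ := by ring
    · refine LipschitzOnWith.of_dist_le_mul fun q _ q' _ => ?_
      rw [dist_eq_norm, ← ContinuousLinearMap.sub_comp, dist_eq_norm, NNReal.coe_one, one_mul]
      refine (ContinuousLinearMap.opNorm_comp_le _ _).trans ?_
      exact mul_le_of_le_one_right (norm_nonneg _)
        ((hbd (x + h) hxh t (Ico_subset_Icc_self ht)).trans hCr)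
    · have ht' := Ico_subset_Icc_self ht
      have hbt := hb _ (hmem x hx t ht')
      have hbt' := hbt.2.2 _ (hmem (x + h) hxh t ht')
      have hn := norm_transport_error_le hC ht' (hxh.le.trans hr2)
        (z := y₀ + t • (x + h)) (y := y₀ + t • x) (by simp [smul_add])
        (hflat _ (hsub (hmem x hx t ht'))) hbt.1 hbt.2.1 hbt'.1 hbt'.2
      rw [dist_eq_norm]
      have e : ∀ q A B D : E →L[ℝ] E, q ∘L A - (q + t • (q ∘L B)) ∘L D =
          q ∘L (A - (D + t • (B ∘L D))) := by
        intro q A B D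
        ext v
        simp
      rw [e]
      refine (ContinuousLinearMap.opNorm_comp_le _ _).trans ?_
      gcongr
      exact hM x hx t ht'
  obtain ⟨T, hT⟩ : ∃ T, T = ContinuousLinearMap.compL ℝ E E E (p x 1) ∘L Γ (y₀ + x) := ⟨_, rfl⟩
  have hO : (fun y => p (y - y₀) 1 - p x 1 - T (y - (y₀ + x))) =O[𝓝 (y₀ + x)]
      fun y => ‖y - (y₀ + x)‖ ^ 2 := by
    refine Asymptotics.IsBigO.of_bound (8 * M * C ^ 2) ?_
    filter_upwards [Metric.isOpen_ball.mem_nhds hy] with y hy'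
    have e : x + (y - (y₀ + x)) = y - y₀ := by abel
    have := main (y - (y₀ + x)) (by rw [e]; exact mem_ball_iff_norm.1 hy')
    rw [e] at this
    simpa [hT] using this
  have hd := (hO.hasFDerivAt (𝕜 := ℝ) one_lt_two).add
    ((T.hasFDerivAt.comp (y₀ + x) ((hasFDerivAt_id (y₀ + x)).sub_const (y₀ + x))).add_const
      (p x 1))
  have hP : (fun y => p (y - y₀) 1) = (fun y => p (y - y₀) 1 - p x 1 - T (y - (y₀ + x))) +
      fun y => (T ∘ fun y => id y - (y₀ + x)) y + p x 1 := by
    ext1 y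
    simp only [Pi.add_apply, Function.comp_apply, id]
    abel
  rw [hP]
  exact hd.congr_fderiv (by rw [hT]; ext; simp)

end Flat

/-! ### Flat metrics are locally Euclidean -/

namespace IsMetricOn

section

variable {E : Type*} [NormedAddCommGroup E] [InnerProductSpace ℝ E] [FiniteDimensional ℝ E]
variable {G : E → E →L[ℝ] E →L[ℝ] ℝ} {s : Set E} {y : E}

/-- A metric at a point is the pullback of the inner product by a linear map. -/
theorem exists_linear_isometry (hG : IsMetricOn G s) (hy : y ∈ s) :
    ∃ P : E →L[ℝ] E, ∀ u v, G y u v = inner ℝ (P u) (P v) := by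
  obtain ⟨b, hb⟩ := LinearMap.BilinForm.exists_orthogonal_basis
    (B := (ContinuousLinearMap.coeLM ℝ ∘ₗ (G y : E →ₗ[ℝ] (E →L[ℝ] ℝ)) : LinearMap.BilinForm ℝ E))
    ⟨fun u v => hG.symm y hy u v⟩
  have hb' : ∀ i j, i ≠ j → G y (b i) (b j) = 0 := fun i j hij => hb hij
  let e := stdOrthonormalBasis ℝ E
  let P : E →ₗ[ℝ] E := b.constr ℝ fun i => √(G y (b i) (b i)) • e i
  have hP : ∀ i, P (b i) = √(G y (b i) (b i)) • e i := fun i => b.constr_basis ℝ _ i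
  refine ⟨LinearMap.toContinuousLinearMap P, fun u v => ?_⟩
  have key : (ContinuousLinearMap.coeLM ℝ ∘ₗ (G y : E →ₗ[ℝ] (E →L[ℝ] ℝ))) =
      (innerₗ E).compl₁₂ P P := by
    refine b.ext fun i => b.ext fun j => ?_
    simp only [LinearMap.compl₁₂_apply, innerₗ_apply_apply, hP, inner_smul_left, inner_smul_right]
    change G y (b i) (b j) = _
    rw [orthonormal_iff_ite.1 e.orthonormal i j]
    by_cases hij : i = j
    · subst hij
      simp [Real.mul_self_sqrt (hG.pos y hy _ (b.ne_zero i)).le]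
    · simp [hij, hb' i j hij]
  exact LinearMap.congr_fun₂ key u v

/-- A parallel coframe which is orthonormal at one point is orthonormal. -/
theorem eq_inner_of_parallel (hG : IsMetricOn G s) {r : ℝ} {y₀ : E}
    (hsub : Metric.ball y₀ r ⊆ s) {P : E → E →L[ℝ] E}
    (hP : ∀ y ∈ Metric.ball y₀ r,
      HasFDerivAt P (ContinuousLinearMap.compL ℝ E E E (P y) ∘L chr G y) y)
    (h₀ : ∀ u v, G y₀ u v = inner ℝ (P y₀ u) (P y₀ v)) (hy : y ∈ Metric.ball y₀ r) (u v : E) :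
    G y u v = inner ℝ (P y u) (P y v) := by
  have hPd : ∀ y ∈ Metric.ball y₀ r, DifferentiableAt ℝ P y := fun y hy =>
    (hP y hy).differentiableAt
  -- the defect `D` solves a linear equation along rays and vanishes at the centre
  obtain ⟨J, hJ⟩ : ∃ J : E →L[ℝ] E →L[ℝ] ℝ, ∀ u v, J u v = inner ℝ u v :=
    ⟨innerSL ℝ, fun _ _ => rfl⟩
  obtain ⟨D, hD⟩ : ∃ D : E → E →L[ℝ] E →L[ℝ] ℝ,
    D = fun z => G z - ((J ∘L P z).flip ∘L P z).flip := ⟨_, rfl⟩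
  have hDa : ∀ z u v, D z u v = G z u v - inner ℝ (P z u) (P z v) := by
    intro z u v; simp [hD, hJ]
  have hDd : ∀ y ∈ Metric.ball y₀ r, DifferentiableAt ℝ D y := by
    intro y hy
    have h1 : DifferentiableAt ℝ (fun z => (J ∘L P z).flip) y :=
      (ContinuousLinearMap.flipₗᵢ ℝ E E ℝ).differentiableAt.comp y
        ((differentiableAt_const _).clm_comp (hPd y hy))
    have h2 : DifferentiableAt ℝ
        (fun z => ((J ∘L P z).flip ∘L P z).flip) y :=
      (ContinuousLinearMap.flipₗᵢ ℝ E E ℝ).differentiableAt.comp y (h1.clm_comp (hPd y hy))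
    rw [hD]
    exact (hG.differentiableAt (hsub hy)).fun_sub h2
  have hDf : ∀ y ∈ Metric.ball y₀ r, ∀ w u v, fderiv ℝ D y w u v =
      D y (chr G y w u) v + D y u (chr G y w v) := by
    intro y hy w u v
    have hc : ∀ a : E, DifferentiableAt ℝ (fun _ : E => a) y := fun a => differentiableAt_const a
    have h1 := fderiv_clm_apply₂_apply (hDd y hy) (hc u) (hc v) w
    have hPa : ∀ a, DifferentiableAt ℝ (fun z => P z a) y := fun a => (hPd y hy).clm_apply (hc a)
    have hPf : ∀ a, fderiv ℝ (fun z => P z a) y w = P y (chr G y w a) := by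
      intro a
      rw [fderiv_clm_apply_apply (hPd y hy) (hc a), (hP y hy).fderiv]
      simp
    simp only [fderiv_fun_const, Pi.zero_apply, zero_apply, map_zero, add_zero] at h1
    rw [← h1]
    simp only [hDa]
    rw [fderiv_fun_sub (((hG.differentiableAt (hsub hy)).clm_apply (hc u)).clm_apply (hc v))
      ((hPa u).inner ℝ (hPa v)), sub_apply, fderiv_inner_apply ℝ (hPa u) (hPa v), hPf, hPf,
      fderiv_clm_apply₂_apply (hG.differentiableAt (hsub hy)) (hc u) (hc v),
      hG.fderiv_eq (hsub hy)]
    simp only [fderiv_fun_const, Pi.zero_apply, zero_apply, map_zero, add_zero]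
    ring
  obtain ⟨x, rfl⟩ : ∃ x, y = y₀ + x := ⟨y - y₀, by abel⟩
  have hx : ‖x‖ < r := by simpa [mem_ball_iff_norm] using hy
  have hmem : ∀ t ∈ Icc (0 : ℝ) 1, y₀ + t • x ∈ Metric.ball y₀ r := by
    intro t ht
    rw [mem_ball_iff_norm, add_sub_cancel_left, norm_smul, Real.norm_eq_abs, abs_of_nonneg ht.1]
    calc t * ‖x‖ ≤ 1 * ‖x‖ := by gcongr; exact ht.2
      _ < r := by linarith
  have hray : ∀ t : ℝ, HasDerivAt (fun t : ℝ => y₀ + t • x) x t := fun t => by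
    simpa using ((hasDerivAt_id t).smul_const x).const_add y₀
  have hder : ∀ t ∈ Icc (0 : ℝ) 1, HasDerivAt (fun t : ℝ => D (y₀ + t • x))
      (fderiv ℝ D (y₀ + t • x) x) t := fun t ht =>
    (hDd _ (hmem t ht)).hasFDerivAt.comp_hasDerivAt_of_eq t (hray t) rfl
  obtain ⟨K, hK⟩ : ∃ K, ∀ t ∈ Icc (0 : ℝ) 1, ‖chr G (y₀ + t • x) x‖ ≤ K := by
    have hcont : ContinuousOn (fun t : ℝ => chr G (y₀ + t • x) x) (Icc 0 1) := fun t ht =>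
      ((((hG.contDiffAt_chr (hsub (hmem t ht))).continuousAt).comp
        (f := fun t : ℝ => y₀ + t • x) (hray t).continuousAt).clm_apply
          continuousAt_const).continuousWithinAt
    exact isCompact_Icc.exists_bound_of_continuousOn hcont
  have hK0 : 0 ≤ K := (norm_nonneg _).trans (hK 0 (by simp))
  have hzero := eq_zero_of_abs_deriv_le_mul_abs_self_of_eq_zero_right (K := 2 * K)
    (fun t ht => (hder t ht).continuousAt.continuousWithinAt)
    (fun t ht => (hder t (Ico_subset_Icc_self ht)).hasDerivWithinAt) (by
      ext u v
      simp [hDa, h₀]) (fun t ht => by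
      have ht' := Ico_subset_Icc_self ht
      refine ContinuousLinearMap.opNorm_le_bound₂ _ (by positivity) fun a b => ?_
      rw [hDf _ (hmem t ht')]
      have e1 := (D (y₀ + t • x)).le_opNorm₂ (chr G (y₀ + t • x) x a) b
      have e2 := (D (y₀ + t • x)).le_opNorm₂ a (chr G (y₀ + t • x) x b)
      have f1 := (chr G (y₀ + t • x) x).le_of_opNorm_le (hK t ht') a
      have f2 := (chr G (y₀ + t • x) x).le_of_opNorm_le (hK t ht') b
      calc _ ≤ ‖D (y₀ + t • x)‖ * (K * ‖a‖) * ‖b‖ + ‖D (y₀ + t • x)‖ * ‖a‖ * (K * ‖b‖) := by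
            refine (norm_add_le _ _).trans (add_le_add (e1.trans ?_) (e2.trans ?_)) <;> gcongr
        _ = _ := by ring) 1 (by simp)
  have := hDa (y₀ + x) u v
  simp only [one_smul] at hzero
  rw [hzero] at this
  simp only [zero_apply] at this
  linarith

/-- A flat metric is locally the pullback of the Euclidean metric by a smooth map. The rows of a
parallel coframe `P` are closed forms because the Christoffel symbols are symmetric, so `P` is the
derivative of a map. -/
theorem exists_isometry_of_flat (hG : IsMetricOn G s)
    (hflat : ∀ z ∈ s, ∀ u v, curv (chr G) z u v = 0) {y₀ : E} (hy₀ : y₀ ∈ s) :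
    ∃ r > 0, Metric.ball y₀ r ⊆ s ∧ ∃ F : E → E, ContDiffOn ℝ ∞ F (Metric.ball y₀ r) ∧
      ∀ z ∈ Metric.ball y₀ r, ∀ u v, G z u v = inner ℝ (fderiv ℝ F z u) (fderiv ℝ F z v) := by
  obtain ⟨P₀, hP₀⟩ := hG.exists_linear_isometry hy₀
  have hΓ : ContDiffOn ℝ ∞ (chr G) s := fun z hz => (hG.contDiffAt_chr hz).contDiffWithinAt
  obtain ⟨r, hr, hsub, P, hPy, hP⟩ := exists_parallel_coframe hG.isOpen hΓ hflat hy₀ P₀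
  have hPd : DifferentiableOn ℝ P (Metric.ball y₀ r) := fun z hz =>
    (hP z hz).differentiableAt.differentiableWithinAt
  obtain ⟨F, hF⟩ := (convex_ball y₀ r).exists_forall_hasFDerivAt_of_fderiv_symmetric
    Metric.isOpen_ball hPd (fun z hz u v => by
      rw [(hP z hz).fderiv]
      simp [hG.chr_symm (hsub hz) u v])
  -- bootstrapping the equation `dP = P ∘ Γ`
  have hPs : ∀ k : ℕ, ContDiffOn ℝ k P (Metric.ball y₀ r) := by
    intro k
    induction k with
    | zero => exact contDiffOn_zero.2 hPd.continuousOn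
    | succ k ih =>
      rw [Nat.cast_add, Nat.cast_one, contDiffOn_succ_iff_fderiv_of_isOpen Metric.isOpen_ball]
      refine ⟨hPd, by simp, ?_⟩
      refine ContDiffOn.congr (f := fun z => ContinuousLinearMap.compL ℝ E E E (P z) ∘L chr G z) ?_
        fun z hz => (hP z hz).fderiv
      exact ((ContinuousLinearMap.contDiff _).comp_contDiffOn ih).clm_comp
        ((hΓ.mono hsub).of_le (by exact_mod_cast le_top))
  refine ⟨r, hr, hsub, F, ?_, fun z hz u v => ?_⟩
  · rw [contDiffOn_infty_iff_fderiv_of_isOpen Metric.isOpen_ball]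
    refine ⟨fun z hz => (hF z hz).differentiableAt.differentiableWithinAt, ?_⟩
    exact (contDiffOn_infty.2 hPs).congr fun z hz => (hF z hz).fderiv
  · rw [(hF z hz).fderiv]
    exact hG.eq_inner_of_parallel hsub hP (by rw [hPy]; exact hP₀) hz u v

end

end IsMetricOn

/-! ### Metrics, fields and functions in the charts of a manifold -/

section Manifold

variable {n : ℕ} {M : Type*} [TopologicalSpace M]
  [ChartedSpace (EuclideanSpace ℝ (Fin n)) M] [IsManifold (𝓡 n) ∞ M]

local notation "𝔼" => EuclideanSpace ℝ (Fin n)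

theorem mdifferentiableAt_chart_symm {p : M} {y : 𝔼}
    (hy : y ∈ (extChartAt (𝓡 n) p).target) :
    MDifferentiableAt (𝓡 n) (𝓡 n) (extChartAt (𝓡 n) p).symm y :=
  (mdifferentiableOn_extChartAt_symm y hy).mdifferentiableAt
    ((isOpen_extChartAt_target p).mem_nhds hy)

theorem chartInvDeriv_chartVec {p x : M} (hx : x ∈ (extChartAt (𝓡 n) p).source)
    (v : TangentSpace (𝓡 n) x) : chartInvDeriv p (extChartAt (𝓡 n) p x) (chartVec p x v) = v := by
  have h := mfderivWithin_extChartAt_symm_comp_mfderiv_extChartAt' (I := 𝓡 n) hx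
  simp only [modelWithCornersSelf_coe, range_id, mfderivWithin_univ] at h
  exact DFunLike.congr_fun h v

theorem chartVec_chartInvDeriv {p : M} {y : 𝔼} (hy : y ∈ (extChartAt (𝓡 n) p).target) (v : 𝔼) :
    chartVec p ((extChartAt (𝓡 n) p).symm y) (chartInvDeriv p y v) = v := by
  have h := mfderiv_extChartAt_comp_mfderivWithin_extChartAt_symm (I := 𝓡 n) hy
  simp only [modelWithCornersSelf_coe, range_id, mfderivWithin_univ] at h
  exact DFunLike.congr_fun h v

theorem chartVec_surjective {p x : M} (hx : x ∈ (extChartAt (𝓡 n) p).source) :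
    Function.Surjective (chartVec (n := n) p x) := fun u =>
  ⟨chartInvDeriv p (extChartAt (𝓡 n) p x) u, by
    have h := chartVec_chartInvDeriv ((extChartAt (𝓡 n) p).map_source hx) u
    rwa [(extChartAt (𝓡 n) p).left_inv hx] at h⟩

theorem chartMetric_apply (g : SmoothMetric n M) (p : M) (y u v : 𝔼) :
    chartMetric g p y u v = g.inner ((extChartAt (𝓡 n) p).symm y) (chartInvDeriv p y u)
      (chartInvDeriv p y v) := rfl

theorem chartMetric_chartVec (g : SmoothMetric n M) {p x : M}
    (hx : x ∈ (extChartAt (𝓡 n) p).source) (u v : TangentSpace (𝓡 n) x) :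
    chartMetric g p (extChartAt (𝓡 n) p x) (chartVec p x u) (chartVec p x v) = g.inner x u v := by
  rw [chartMetric_apply, chartInvDeriv_chartVec hx, chartInvDeriv_chartVec hx,
    (extChartAt (𝓡 n) p).left_inv hx]

/-- A constant vector field in a chart, as a section of the tangent bundle along the inverse
chart. -/
theorem contMDiffOn_chartInvDeriv (p : M) (u : 𝔼) :
    ContMDiffOn (𝓡 n) (𝓡 n).tangent ∞ (fun y => (⟨(extChartAt (𝓡 n) p).symm y,
      chartInvDeriv p y u⟩ : TangentBundle (𝓡 n) M)) (extChartAt (𝓡 n) p).target := by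
  have ho := isOpen_extChartAt_target (I := 𝓡 n) p
  have h1 := (contMDiffOn_extChartAt_symm (I := 𝓡 n) (n := ∞) p).contMDiffOn_tangentMapWithin
    (m := ∞) (by simp) ho.uniqueMDiffOn
  have h2 : ContMDiffOn (𝓡 n) (𝓡 n).tangent ∞ (fun y : 𝔼 => (⟨y, u⟩ : TangentBundle (𝓡 n) 𝔼))
      (extChartAt (𝓡 n) p).target :=
    contMDiffOn_vectorSpace_iff_contDiffOn.2 contDiffOn_const
  refine (h1.comp h2 fun y hy => hy).congr fun y hy => ?_
  simp only [Function.comp_apply, tangentMapWithin]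
  rw [mfderivWithin_of_isOpen ho hy]
  rfl

theorem isMetricOn_chartMetric (g : SmoothMetric n M) (p : M) :
    IsMetricOn (chartMetric g p) (extChartAt (𝓡 n) p).target where
  isOpen := isOpen_extChartAt_target p
  contDiffOn := by
    rw [contDiffOn_clm_apply]
    intro u
    rw [contDiffOn_clm_apply]
    intro v
    have hs := contMDiffOn_extChartAt_symm (I := 𝓡 n) (n := ∞) p
    have h : ContMDiffOn (𝓡 n) ((𝓡 n).prod 𝓘(ℝ, ℝ)) ∞ (fun y : 𝔼 => TotalSpace.mk' ℝ
        (E := Bundle.Trivial M ℝ) ((extChartAt (𝓡 n) p).symm y)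
        (g.inner ((extChartAt (𝓡 n) p).symm y) (chartInvDeriv p y u) (chartInvDeriv p y v)))
        (extChartAt (𝓡 n) p).target := by
      apply ContMDiffOn.clm_bundle_apply₂ (F₁ := 𝔼) (F₂ := 𝔼)
      · exact g.contMDiff.comp_contMDiffOn hs
      · exact contMDiffOn_chartInvDeriv p u
      · exact contMDiffOn_chartInvDeriv p v
    intro y hy
    have h' := h y hy
    simp only [contMDiffWithinAt_totalSpace] at h'
    exact h'.2.contDiffWithinAt
  symm y hy u v := by
    rw [chartMetric_apply, chartMetric_apply]
    exact g.symm _ _ _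
  pos y hy u hu := by
    rw [chartMetric_apply]
    refine g.pos _ _ fun h => hu ?_
    rw [← chartVec_chartInvDeriv hy u]
    have : chartInvDeriv p y u = 0 := h
    rw [this]
    exact map_zero (mfderiv (𝓡 n) (𝓡 n) (extChartAt (𝓡 n) p) _)

theorem contDiffOn_chartField {X : ∀ x : M, TangentSpace (𝓡 n) x}
    (hX : ContMDiff (𝓡 n) (𝓡 n).tangent ∞ (fun x => (⟨x, X x⟩ : TangentBundle (𝓡 n) M))) (p : M) :
    ContDiffOn ℝ ∞ (chartField X p) (extChartAt (𝓡 n) p).target := by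
  have ho := isOpen_extChartAt_source (I := 𝓡 n) p
  have h1 := (contMDiffOn_extChartAt (I := 𝓡 n) (n := ∞) (x := p)).contMDiffOn_tangentMapWithin
    (m := ∞) (by simp) (chartAt _ p).open_source.uniqueMDiffOn
  have h2 := hX.comp_contMDiffOn (contMDiffOn_extChartAt_symm (I := 𝓡 n) (n := ∞) p)
  refine contMDiffOn_vectorSpace_iff_contDiffOn.1 ((h1.comp h2 fun y hy => ?_).congr
    fun y hy => ?_)
  · simpa using (extChartAt (𝓡 n) p).map_target hy
  · have hs := (extChartAt (𝓡 n) p).map_target hy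
    simp only [Function.comp_apply, tangentMapWithin]
    rw [extChartAt_source] at hs
    rw [mfderivWithin_of_isOpen (chartAt _ p).open_source hs, (extChartAt (𝓡 n) p).right_inv hy]
    rfl

/-- The derivative of a change of charts maps the components of a tangent vector in one chart to
its components in the other. -/
theorem fderiv_transition {p q x : M} (hp : x ∈ (extChartAt (𝓡 n) p).source)
    (hq : x ∈ (extChartAt (𝓡 n) q).source) (v : TangentSpace (𝓡 n) x) :
    fderiv ℝ (extChartAt (𝓡 n) q ∘ (extChartAt (𝓡 n) p).symm) (extChartAt (𝓡 n) p x)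
      (chartVec p x v) = chartVec q x v := by
  have hy := (extChartAt (𝓡 n) p).map_source hp
  have hl := (extChartAt (𝓡 n) p).left_inv hp
  rw [← mfderiv_eq_fderiv, mfderiv_comp (I' := 𝓡 n)]
  · change mfderiv _ _ _ _ (chartInvDeriv p _ (chartVec p x v)) = _
    rw [chartInvDeriv_chartVec hp, hl]
    rfl
  · rw [hl]
    exact mdifferentiableAt_extChartAt (by simpa using hq)
  · exact mdifferentiableAt_chart_symm hy

/-- Changes of charts are isometries between the chart metrics. -/
theorem isIsometryOn_transition (g : SmoothMetric n M) (p q : M) :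
    IsIsometryOn (extChartAt (𝓡 n) q ∘ (extChartAt (𝓡 n) p).symm) (chartMetric g p)
      ((extChartAt (𝓡 n) p).target ∩ (extChartAt (𝓡 n) p).symm ⁻¹' (extChartAt (𝓡 n) q).source)
      (chartMetric g q) (extChartAt (𝓡 n) q).target where
  source := (isMetricOn_chartMetric g p).mono
    ((continuousOn_extChartAt_symm p).isOpen_inter_preimage (isOpen_extChartAt_target p)
      (isOpen_extChartAt_source q)) inter_subset_left
  target := isMetricOn_chartMetric g q
  mapsTo z hz := (extChartAt (𝓡 n) q).map_source hz.2
  contDiffAt z hz := by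
    have h := ((contMDiffAt_extChartAt' (I := 𝓡 n) (n := ∞) (x := q)
      (by simpa using hz.2)).comp z ((contMDiffOn_extChartAt_symm (I := 𝓡 n) (n := ∞) p).contMDiffAt
        ((isOpen_extChartAt_target p).mem_nhds hz.1)))
    exact h.contDiffAt
  pullback z hz u v := by
    obtain ⟨x, hx, rfl⟩ : ∃ x ∈ (extChartAt (𝓡 n) p).source, extChartAt (𝓡 n) p x = z :=
      ⟨_, (extChartAt (𝓡 n) p).map_target hz.1, (extChartAt (𝓡 n) p).right_inv hz.1⟩
    have hl := (extChartAt (𝓡 n) p).left_inv hx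
    have hq : x ∈ (extChartAt (𝓡 n) q).source := by have := hz.2; rwa [mem_preimage, hl] at this
    obtain ⟨u, rfl⟩ := chartVec_surjective hx u
    obtain ⟨v, rfl⟩ := chartVec_surjective hx v
    rw [fderiv_transition hx hq, fderiv_transition hx hq, Function.comp_apply, hl,
      chartMetric_chartVec g hx, chartMetric_chartVec g hq]

end Manifold

section Manifold

variable {n : ℕ} {M : Type*} [TopologicalSpace M]
  [ChartedSpace (EuclideanSpace ℝ (Fin n)) M] [IsManifold (𝓡 n) ∞ M]

local notation "𝔼" => EuclideanSpace ℝ (Fin n)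

/-! ### Curvature and Lie derivative in an arbitrary chart -/

omit [IsManifold (𝓡 n) ∞ M] in
theorem chartVec_add (p x : M) (u v : TangentSpace (𝓡 n) x) :
    chartVec p x (u + v) = chartVec p x u + chartVec p x v :=
  map_add (mfderiv (𝓡 n) (𝓡 n) (extChartAt (𝓡 n) p) x) u v

omit [IsManifold (𝓡 n) ∞ M] in
theorem chartVec_smul (p x : M) (a : ℝ) (u : TangentSpace (𝓡 n) x) :
    chartVec p x (a • u) = a • chartVec p x u :=
  map_smul (mfderiv (𝓡 n) (𝓡 n) (extChartAt (𝓡 n) p) x) a u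

omit [IsManifold (𝓡 n) ∞ M] in
theorem chartField_extChartAt (X : ∀ x : M, TangentSpace (𝓡 n) x) {p x : M}
    (hx : x ∈ (extChartAt (𝓡 n) p).source) :
    chartField X p (extChartAt (𝓡 n) p x) = chartVec p x (X x) := by
  simp only [chartField]
  rw [(extChartAt (𝓡 n) p).left_inv hx]

/-- The curvature form, defined through the preferred chart at `x`, may be computed in any chart. -/
theorem curvatureForm_eq (g : SmoothMetric n M) {p x : M} (hx : x ∈ (extChartAt (𝓡 n) p).source)
    (u v : TangentSpace (𝓡 n) x) :
    curvatureForm g x u v = chartMetric g p (extChartAt (𝓡 n) p x)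
      (curv (chr (chartMetric g p)) (extChartAt (𝓡 n) p x)
        (chartVec p x u) (chartVec p x v) (chartVec p x v)) (chartVec p x u) := by
  have hxx := mem_extChartAt_source (I := 𝓡 n) x
  have hl := (extChartAt (𝓡 n) p).left_inv hx
  have iso := isIsometryOn_transition g p x
  have hy : extChartAt (𝓡 n) p x ∈ (extChartAt (𝓡 n) p).target ∩
      (extChartAt (𝓡 n) p).symm ⁻¹' (extChartAt (𝓡 n) x).source :=
    ⟨(extChartAt (𝓡 n) p).map_source hx, by rw [mem_preimage, hl]; exact hxx⟩
  rw [iso.pullback _ hy, iso.fderiv_curv hy, fderiv_transition hx hxx, fderiv_transition hx hxx,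
    Function.comp_apply, hl, curvatureForm,
    (isMetricOn_chartMetric g x).coordCurvature_eq (mem_extChartAt_target x)]

/-- The Lie derivative, defined through the preferred chart at `x`, may be computed in any chart. -/
theorem lieDeriv_eq (g : SmoothMetric n M) {X : ∀ x : M, TangentSpace (𝓡 n) x}
    (hX : ∀ q, ContDiffOn ℝ ∞ (chartField X q) (extChartAt (𝓡 n) q).target)
    {p x : M} (hx : x ∈ (extChartAt (𝓡 n) p).source) (u v : TangentSpace (𝓡 n) x) :
    lieDeriv g X x u v = coordLieDeriv (chartMetric g p) (chartField X p) (extChartAt (𝓡 n) p x)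
        (chartVec p x u) (chartVec p x v) := by
  have hxx := mem_extChartAt_source (I := 𝓡 n) x
  have hl := (extChartAt (𝓡 n) p).left_inv hx
  have iso := isIsometryOn_transition g p x
  have hy : extChartAt (𝓡 n) p x ∈ (extChartAt (𝓡 n) p).target ∩
      (extChartAt (𝓡 n) p).symm ⁻¹' (extChartAt (𝓡 n) x).source :=
    ⟨(extChartAt (𝓡 n) p).map_source hx, by rw [mem_preimage, hl]; exact hxx⟩
  have hd : ∀ q, ∀ z ∈ (extChartAt (𝓡 n) q).target, DifferentiableAt ℝ (chartField X q) z :=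
    fun q z hz => ((hX q).contDiffAt
      ((isOpen_extChartAt_target q).mem_nhds hz)).differentiableAt_of_smooth
  rw [iso.coordLieDeriv_eq hy (hd _ _ hy.1) (hd _ _ (iso.mapsTo hy)), fderiv_transition hx hxx,
    fderiv_transition hx hxx, Function.comp_apply, hl, lieDeriv]
  intro z hz
  obtain ⟨x', hx', rfl⟩ : ∃ x' ∈ (extChartAt (𝓡 n) p).source, extChartAt (𝓡 n) p x' = z :=
    ⟨_, (extChartAt (𝓡 n) p).map_target hz.1, (extChartAt (𝓡 n) p).right_inv hz.1⟩
  have hl' := (extChartAt (𝓡 n) p).left_inv hx'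
  have hq : x' ∈ (extChartAt (𝓡 n) x).source := by have := hz.2; rwa [mem_preimage, hl'] at this
  rw [chartField_extChartAt X hx', fderiv_transition hx' hq, Function.comp_apply, hl',
    chartField_extChartAt X hq]

theorem lieDeriv_add_left (g : SmoothMetric n M) (X : ∀ x : M, TangentSpace (𝓡 n) x) (x : M)
    (u v w : TangentSpace (𝓡 n) x) :
    lieDeriv g X x (u + v) w = lieDeriv g X x u w + lieDeriv g X x v w := by
  simp only [lieDeriv, coordLieDeriv, chartVec_add, map_add, add_apply]
  ring

theorem lieDeriv_smul_left (g : SmoothMetric n M) (X : ∀ x : M, TangentSpace (𝓡 n) x) (x : M)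
    (a : ℝ) (u w : TangentSpace (𝓡 n) x) :
    lieDeriv g X x (a • u) w = a * lieDeriv g X x u w := by
  simp only [lieDeriv, coordLieDeriv, chartVec_smul, map_smul, smul_apply,
    smul_eq_mul]
  ring

theorem lieDeriv_symm (g : SmoothMetric n M) (X : ∀ x : M, TangentSpace (𝓡 n) x) (x : M)
    (u v : TangentSpace (𝓡 n) x) : lieDeriv g X x u v = lieDeriv g X x v u :=
  (isMetricOn_chartMetric g x).coordLieDeriv_symm (mem_extChartAt_target x) _ _ _

/-! ### Sectional curvature -/

theorem sec_eq_curvatureForm {g : SmoothMetric n M} {x : M} {u v : TangentSpace (𝓡 n) x}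
    (h : OrthonormalPair g x u v) : sec g x u v = curvatureForm g x u v := by
  rw [sec, h.1, h.2.1, h.2.2]
  norm_num

theorem OrthonormalPair.swap {g : SmoothMetric n M} {x : M} {u v : TangentSpace (𝓡 n) x}
    (h : OrthonormalPair g x u v) : OrthonormalPair g x v u :=
  ⟨h.2.1, h.1, by rw [g.symm, h.2.2]⟩

theorem curvatureForm_symm (g : SmoothMetric n M) (x : M) (u v : TangentSpace (𝓡 n) x) :
    curvatureForm g x u v = curvatureForm g x v u := by
  have hx := mem_extChartAt_source (I := 𝓡 n) x
  rw [curvatureForm_eq g hx, curvatureForm_eq g hx,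
    (isMetricOn_chartMetric g x).curv_form_symm (mem_extChartAt_target x)]

theorem sec_symm {g : SmoothMetric n M} {x : M} {u v : TangentSpace (𝓡 n) x}
    (h : OrthonormalPair g x u v) : sec g x u v = sec g x v u := by
  rw [sec_eq_curvatureForm h, sec_eq_curvatureForm h.swap, curvatureForm_symm]

theorem sec_smul (g : SmoothMetric n M) (x : M) {a : ℝ} (ha : a ≠ 0)
    (u v : TangentSpace (𝓡 n) x) : sec g x (a • u) (a • v) = sec g x u v := by
  have hx := mem_extChartAt_source (I := 𝓡 n) x
  have h1 : curvatureForm g x (a • u) (a • v) = a ^ 4 * curvatureForm g x u v := by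
    rw [curvatureForm_eq g hx, curvatureForm_eq g hx]
    simp only [chartVec_smul, map_smul, smul_apply, smul_eq_mul]
    ring
  have h2 : g.inner x (a • u) (a • u) * g.inner x (a • v) (a • v) - g.inner x (a • u) (a • v) ^ 2
      = a ^ 4 * (g.inner x u u * g.inner x v v - g.inner x u v ^ 2) := by
    have h : ∀ u v : TangentSpace (𝓡 n) x,
        g.inner x (a • u) (a • v) = a * (a * g.inner x u v) := by
      intro u v
      rw [map_smul, map_smul]
      rfl
    rw [h, h, h]
    ring
  rw [sec, h1, h2, mul_div_mul_left _ _ (pow_ne_zero 4 ha), sec]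

/-- If the sectional curvatures at each point agree, then the curvature tensor in every chart has
the constant curvature form. -/
theorem curv_eq_of_sec (g : SmoothMetric n M) {κ : M → ℝ}
    (h : ∀ x u v, OrthonormalPair g x u v → sec g x u v = κ x) (p : M) :
    ∀ z ∈ (extChartAt (𝓡 n) p).target, ∀ u v w, curv (chr (chartMetric g p)) z u v w =
      κ ((extChartAt (𝓡 n) p).symm z) •
        (chartMetric g p z v w • u - chartMetric g p z u w • v) := by
  intro z hz
  obtain ⟨x, hx, rfl⟩ : ∃ x ∈ (extChartAt (𝓡 n) p).source, extChartAt (𝓡 n) p x = z :=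
    ⟨_, (extChartAt (𝓡 n) p).map_target hz, (extChartAt (𝓡 n) p).right_inv hz⟩
  rw [(extChartAt (𝓡 n) p).left_inv hx]
  refine (isMetricOn_chartMetric g p).curv_eq_of_sec_eq hz fun u v hu hv huv => ?_
  obtain ⟨u, rfl⟩ := chartVec_surjective hx u
  obtain ⟨v, rfl⟩ := chartVec_surjective hx v
  rw [chartMetric_chartVec g hx] at hu hv huv
  rw [← curvatureForm_eq g hx, ← sec_eq_curvatureForm ⟨hu, hv, huv⟩, h x u v ⟨hu, hv, huv⟩]

/-- **Schur's lemma.** -/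
theorem hasConstantCurvature_of_sec [ConnectedSpace M] (hn : 2 < n) {g : SmoothMetric n M}
    {κ : M → ℝ} (h : ∀ x u v, OrthonormalPair g x u v → sec g x u v = κ x) :
    HasConstantCurvature g := by
  have hloc : IsLocallyConstant κ := by
    rw [IsLocallyConstant.iff_eventually_eq]
    intro p
    have ht := isOpen_extChartAt_target (I := 𝓡 n) p
    have hs := isOpen_extChartAt_source (I := 𝓡 n) p
    obtain ⟨r, hr, hb⟩ := Metric.isOpen_iff.1 ht _ (mem_extChartAt_target p)
    have hc : ∀ z ∈ Metric.ball (extChartAt (𝓡 n) p p) r,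
        κ ((extChartAt (𝓡 n) p).symm z) = κ p := by
      intro z hz
      have hd : ∀ z ∈ Metric.ball (extChartAt (𝓡 n) p p) r, HasFDerivWithinAt
          (fun z => κ ((extChartAt (𝓡 n) p).symm z)) (0 : 𝔼 →L[ℝ] ℝ)
          (Metric.ball (extChartAt (𝓡 n) p p) r) z := fun z hz =>
        ((isMetricOn_chartMetric g p).hasFDerivAt_sec_zero (by simpa using hn)
          (curv_eq_of_sec g h p) (hb hz)).hasFDerivWithinAt
      have := (convex_ball (extChartAt (𝓡 n) p p) r).norm_image_sub_le_of_norm_hasFDerivWithin_le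
        (C := 0) hd (by simp) (Metric.mem_ball_self hr) hz
      rw [zero_mul, norm_le_zero_iff, sub_eq_zero] at this
      rw [this, (extChartAt (𝓡 n) p).left_inv (mem_extChartAt_source p)]
    filter_upwards [hs.mem_nhds (mem_extChartAt_source p),
      (continuousAt_extChartAt (I := 𝓡 n) p).preimage_mem_nhds (Metric.ball_mem_nhds _ hr)]
      with x hx hxb
    rw [← hc _ hxb, (extChartAt (𝓡 n) p).left_inv hx]
  obtain ⟨p⟩ := (inferInstance : Nonempty M)
  exact ⟨κ p, fun x u v hx => (h x u v hx).trans (hloc.apply_eq_of_isPreconnected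
    isPreconnected_univ (mem_univ _) (mem_univ _))⟩

/-! ### Gradients and conformal metrics -/

/-- The metric at a single point `x`, as a constant metric on the model space: this makes the linear
algebra of `IsMetricOn` available in `T_x M`. -/
theorem isMetricOn_metricForm (g : SmoothMetric n M) (x : M) :
    IsMetricOn (fun _ : 𝔼 => metricForm g x) univ where
  isOpen := isOpen_univ
  contDiffOn := contDiffOn_const
  symm _ _ u v := g.symm x u v
  pos _ _ u hu := g.pos x u hu

theorem inner_gradient (g : SmoothMetric n M) (f : M → ℝ) (x : M) (v : TangentSpace (𝓡 n) x) :
    g.inner x (gradient g f x) v = mfderiv (𝓡 n) 𝓘(ℝ, ℝ) f x v :=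
  DFunLike.congr_fun ((isMetricOn_metricForm g x).apply_inverse (mem_univ (0 : 𝔼))
    (mfderiv (𝓡 n) 𝓘(ℝ, ℝ) f x)) v

theorem contDiffOn_comp_chart {f : M → ℝ} (hf : ContMDiff (𝓡 n) 𝓘(ℝ, ℝ) ∞ f) (p : M) :
    ContDiffOn ℝ ∞ (fun z => f ((extChartAt (𝓡 n) p).symm z)) (extChartAt (𝓡 n) p).target :=
  (hf.comp_contMDiffOn (contMDiffOn_extChartAt_symm p)).contDiffOn

theorem fderiv_comp_chart {f : M → ℝ} (hf : ContMDiff (𝓡 n) 𝓘(ℝ, ℝ) ∞ f) {p : M} {z : 𝔼}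
    (hz : z ∈ (extChartAt (𝓡 n) p).target) (w : 𝔼) :
    fderiv ℝ (fun z => f ((extChartAt (𝓡 n) p).symm z)) z w =
      mfderiv (𝓡 n) 𝓘(ℝ, ℝ) f ((extChartAt (𝓡 n) p).symm z) (chartInvDeriv p z w) := by
  have h := mfderiv_comp z (hf.mdifferentiable (by simp) ((extChartAt (𝓡 n) p).symm z))
    (mdifferentiableAt_chart_symm hz)
  rw [mfderiv_eq_fderiv] at h
  exact DFunLike.congr_fun h w

theorem chartField_gradient (g : SmoothMetric n M) {f : M → ℝ}
    (hf : ContMDiff (𝓡 n) 𝓘(ℝ, ℝ) ∞ f) {p : M} {z : 𝔼} (hz : z ∈ (extChartAt (𝓡 n) p).target) :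
    chartField (gradient g f) p z =
      coordGrad (chartMetric g p) (fun z => f ((extChartAt (𝓡 n) p).symm z)) z := by
  refine (isMetricOn_chartMetric g p).ext hz fun w => ?_
  rw [(isMetricOn_chartMetric g p).apply_coordGrad hz, fderiv_comp_chart hf hz]
  refine Eq.trans ?_ (inner_gradient g f _ (chartInvDeriv p z w))
  rw [chartMetric_apply]
  have h := chartInvDeriv_chartVec ((extChartAt (𝓡 n) p).map_target hz)
    (gradient g f ((extChartAt (𝓡 n) p).symm z))
  rw [(extChartAt (𝓡 n) p).right_inv hz] at h
  rw [chartField, h]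

theorem lieDeriv_gradient (g : SmoothMetric n M) {f : M → ℝ}
    (hf : ContMDiff (𝓡 n) 𝓘(ℝ, ℝ) ∞ f) (x : M) (u v : TangentSpace (𝓡 n) x) :
    lieDeriv g (gradient g f) x u v = 2 * coordHess (chartMetric g x)
      (fun z => f ((extChartAt (𝓡 n) x).symm z)) (extChartAt (𝓡 n) x x)
      (chartVec x x u) (chartVec x x v) := by
  have hy := mem_extChartAt_target (I := 𝓡 n) x
  rw [← (isMetricOn_chartMetric g x).coordLieDeriv_coordGrad (contDiffOn_comp_chart hf x) hy,
    lieDeriv, coordLieDeriv, coordLieDeriv]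
  have he : chartField (gradient g f) x =ᶠ[𝓝 (extChartAt (𝓡 n) x x)]
      coordGrad (chartMetric g x) (fun z => f ((extChartAt (𝓡 n) x).symm z)) := by
    filter_upwards [(isOpen_extChartAt_target x).mem_nhds hy] with z hz
      using chartField_gradient g hf hz
  rw [he.fderiv_eq, he.eq_of_nhds]

theorem chartMetric_conformal (g : SmoothMetric n M) {f : M → ℝ}
    (hf : ContMDiff (𝓡 n) 𝓘(ℝ, ℝ) ∞ f) (p : M) :
    chartMetric (conformalMetric g f hf) p =
      fun z => Real.exp (-2 * f ((extChartAt (𝓡 n) p).symm z)) • chartMetric g p z := by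
  ext z u v
  rfl

theorem inner_conformal (g : SmoothMetric n M) {f : M → ℝ}
    (hf : ContMDiff (𝓡 n) 𝓘(ℝ, ℝ) ∞ f) (x : M) (u v : TangentSpace (𝓡 n) x) :
    (conformalMetric g f hf).inner x u v = Real.exp (-2 * f x) * g.inner x u v := rfl

/-- The bilinear form `Hess f + df ⊗ df`, with the Hessian encoded as half the Lie derivative of `g`
along the gradient. The strongly weighted curvature of `∇f` is `sec(V, U) + weightedHess(V, V)`. -/
def weightedHess (g : SmoothMetric n M) (f : M → ℝ) (x : M) (u v : TangentSpace (𝓡 n) x) : ℝ :=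
  1 / 2 * lieDeriv g (gradient g f) x u v +
    g.inner x (gradient g f x) u * g.inner x (gradient g f x) v

/-- The conformal change of sectional curvature. -/
theorem sec_conformal (g : SmoothMetric n M) {f : M → ℝ} (hf : ContMDiff (𝓡 n) 𝓘(ℝ, ℝ) ∞ f)
    {x : M} {u v : TangentSpace (𝓡 n) x} (h : OrthonormalPair g x u v) :
    sec (conformalMetric g f hf) x u v = Real.exp (2 * f x) * (sec g x u v
      + weightedHess g f x u u + weightedHess g f x v v
      - g.inner x (gradient g f x) (gradient g f x)) := by
  have hx := mem_extChartAt_source (I := 𝓡 n) x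
  have hy := mem_extChartAt_target (I := 𝓡 n) x
  have hl := (extChartAt (𝓡 n) x).left_inv hx
  have hG := isMetricOn_chartMetric g x
  have hd : ∀ w : TangentSpace (𝓡 n) x, fderiv ℝ (fun z => f ((extChartAt (𝓡 n) x).symm z))
      (extChartAt (𝓡 n) x x) (chartVec x x w) = g.inner x (gradient g f x) w := by
    intro w
    rw [fderiv_comp_chart hf hy, chartInvDeriv_chartVec hx, hl, inner_gradient]
  have hgr : coordGrad (chartMetric g x) (fun z => f ((extChartAt (𝓡 n) x).symm z))
      (extChartAt (𝓡 n) x x) = chartVec x x (gradient g f x) := by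
    rw [← chartField_gradient g hf hy, chartField_extChartAt _ hx]
  have hc := hG.curv_conformal (contDiffOn_comp_chart hf x) hy
    (u := chartVec x x u) (v := chartVec x x v)
    (by rw [chartMetric_chartVec g hx, h.1]) (by rw [chartMetric_chartVec g hx, h.2.1])
    (by rw [chartMetric_chartVec g hx, h.2.2])
  rw [hgr, hd, hd, hd, ← curvatureForm_eq g hx, ← sec_eq_curvatureForm h] at hc
  have he : Real.exp (-2 * f x) * Real.exp (2 * f x) = 1 := by rw [← Real.exp_add]; simp
  rw [sec, curvatureForm_eq _ hx, chartMetric_conformal]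
  simp only [smul_apply, smul_eq_mul, inner_conformal]
  rw [hc, hl, h.1, h.2.1, h.2.2, weightedHess, weightedHess, lieDeriv_gradient g hf,
    lieDeriv_gradient g hf]
  rw [div_eq_iff (by simp [Real.exp_ne_zero])]
  linear_combination (-Real.exp (-2 * f x) * (sec g x u v + coordHess (chartMetric g x)
      (fun z => f ((extChartAt (𝓡 n) x).symm z)) (extChartAt (𝓡 n) x x)
      (chartVec x x u) (chartVec x x u) + coordHess (chartMetric g x)
      (fun z => f ((extChartAt (𝓡 n) x).symm z)) (extChartAt (𝓡 n) x x)
      (chartVec x x v) (chartVec x x v) + g.inner x (gradient g f x) u ^ 2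
      + g.inner x (gradient g f x) v ^ 2 - g.inner x (gradient g f x) (gradient g f x))) * he

theorem OrthonormalPair.conformal {g : SmoothMetric n M} {f : M → ℝ}
    (hf : ContMDiff (𝓡 n) 𝓘(ℝ, ℝ) ∞ f) {x : M} {u v : TangentSpace (𝓡 n) x}
    (h : OrthonormalPair g x u v) : OrthonormalPair (conformalMetric g f hf) x
      (Real.exp (f x) • u) (Real.exp (f x) • v) := by
  have he : Real.exp (-2 * f x) * (Real.exp (f x) * Real.exp (f x)) = 1 := by
    rw [← Real.exp_add, ← Real.exp_add]
    ring_nf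
    simp
  have key : ∀ a b : TangentSpace (𝓡 n) x, (conformalMetric g f hf).inner x
      (Real.exp (f x) • a) (Real.exp (f x) • b) = g.inner x a b := by
    intro a b
    rw [inner_conformal]
    have : g.inner x (Real.exp (f x) • a) (Real.exp (f x) • b) =
        Real.exp (f x) * (Real.exp (f x) * g.inner x a b) := by
      rw [map_smul, map_smul]; rfl
    rw [this]
    linear_combination g.inner x a b * he
  exact ⟨(key _ _).trans h.1, (key _ _).trans h.2.1, (key _ _).trans h.2.2⟩

theorem OrthonormalPair.of_conformal {g : SmoothMetric n M} {f : M → ℝ}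
    (hf : ContMDiff (𝓡 n) 𝓘(ℝ, ℝ) ∞ f) {x : M} {u v : TangentSpace (𝓡 n) x}
    (h : OrthonormalPair (conformalMetric g f hf) x u v) : OrthonormalPair g x
      (Real.exp (-f x) • u) (Real.exp (-f x) • v) := by
  have key : ∀ a b : TangentSpace (𝓡 n) x, g.inner x
      (Real.exp (-f x) • a) (Real.exp (-f x) • b) = (conformalMetric g f hf).inner x a b := by
    intro a b
    have : g.inner x (Real.exp (-f x) • a) (Real.exp (-f x) • b) =
        Real.exp (-f x) * (Real.exp (-f x) * g.inner x a b) := by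
      rw [map_smul, map_smul]; rfl
    rw [this, inner_conformal, ← mul_assoc, ← Real.exp_add]
    ring_nf
  exact ⟨(key _ _).trans h.1, (key _ _).trans h.2.1, (key _ _).trans h.2.2⟩

/-- Orthonormal pairs for `g` and for `e^{-2f} g` span the same planes. -/
theorem sec_conformal_eq_iff (g : SmoothMetric n M) {f : M → ℝ}
    (hf : ContMDiff (𝓡 n) 𝓘(ℝ, ℝ) ∞ f) (x : M) (k : ℝ) :
    (∀ u v, OrthonormalPair (conformalMetric g f hf) x u v →
      sec (conformalMetric g f hf) x u v = k) ↔
    ∀ u v, OrthonormalPair g x u v → sec (conformalMetric g f hf) x u v = k := by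
  constructor
  · intro h u v huv
    rw [← sec_smul _ x (Real.exp_ne_zero (f x))]
    exact h _ _ (huv.conformal hf)
  · intro h u v huv
    rw [← sec_smul _ x (Real.exp_ne_zero (-f x))]
    exact h _ _ (huv.of_conformal hf)

end Manifold

/-! ### Isotropic bilinear forms -/

section Algebra

variable {E : Type*} [NormedAddCommGroup E] [NormedSpace ℝ E] [FiniteDimensional ℝ E]
variable {G : E → E →L[ℝ] E →L[ℝ] ℝ} {s : Set E} {y : E}

/-- A symmetric bilinear form that takes equal values at the two vectors of each orthonormal pair
is a multiple of the metric, in dimension at least three. -/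
theorem IsMetricOn.exists_eq_mul (hG : IsMetricOn G s) (hy : y ∈ s)
    (hE : 2 < Module.finrank ℝ E) {L : E → E → ℝ}
    (hadd : ∀ u v w, L (u + v) w = L u w + L v w) (hsmul : ∀ (a : ℝ) u v, L (a • u) v = a * L u v)
    (hsymm : ∀ u v, L u v = L v u)
    (h : ∀ u v, G y u u = 1 → G y v v = 1 → G y u v = 0 → L u u = L v v) :
    ∃ c, ∀ u v, L u v = c * G y u v := by
  obtain ⟨e, he, -⟩ := hG.exists_unit_orthogonal hy hE 0 0
  -- compare any two unit vectors through a unit vector orthogonal to both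
  have h1 : ∀ u, G y u u = 1 → L u u = L e e := by
    intro u hu
    obtain ⟨w, hw, hew, huw⟩ := hG.exists_unit_orthogonal hy hE e u
    rw [h u w hu hw huw, h e w he hw hew]
  have h2 : ∀ u, L u u = L e e * G y u u := by
    intro u
    by_cases hu : u = 0
    · subst hu
      have := hsmul 0 0 0
      rw [zero_smul, zero_mul] at this
      simp [this]
    · obtain ⟨a, ha, hau⟩ := hG.exists_unit_smul hy hu
      have h3 := h1 _ hau
      rw [hsmul, hsymm, hsmul] at h3
      simp only [map_smul, smul_apply, smul_eq_mul] at hau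
      have ha' : a⁻¹ ≠ 0 := inv_ne_zero ha.ne'
      apply mul_left_cancel₀ (mul_ne_zero ha' ha')
      linear_combination h3 - L e e * hau
  refine ⟨L e e, fun u v => ?_⟩
  have h4 := h2 (u + v)
  rw [hadd, hsymm u, hsymm v, hadd, hadd, h2 u, h2 v, hsymm v u] at h4
  simp only [map_add, add_apply] at h4
  rw [hG.symm y hy v u] at h4
  linarith

/-- A variant of `IsMetricOn.exists_eq_mul` in which the sum of the two values is constant. -/
theorem IsMetricOn.exists_eq_mul_of_add_eq (hG : IsMetricOn G s) (hy : y ∈ s)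
    (hE : 2 < Module.finrank ℝ E) {L : E → E → ℝ} {k : ℝ}
    (hadd : ∀ u v w, L (u + v) w = L u w + L v w) (hsmul : ∀ (a : ℝ) u v, L (a • u) v = a * L u v)
    (hsymm : ∀ u v, L u v = L v u)
    (h : ∀ u v, G y u u = 1 → G y v v = 1 → G y u v = 0 → L u u + L v v = k) :
    ∃ c, ∀ u v, L u v = c * G y u v := by
  refine hG.exists_eq_mul hy hE hadd hsmul hsymm fun u v hu hv huv => ?_
  obtain ⟨w, hw, huw, hvw⟩ := hG.exists_unit_orthogonal hy hE u v
  linarith [h u w hu hw huw, h v w hv hw hvw]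

end Algebra

section Manifold

variable {n : ℕ} {M : Type*} [TopologicalSpace M]
  [ChartedSpace (EuclideanSpace ℝ (Fin n)) M] [IsManifold (𝓡 n) ∞ M]

local notation "𝔼" => EuclideanSpace ℝ (Fin n)

/-! ### Flat manifolds are locally Euclidean -/

/-- A smooth map whose derivative is everywhere bijective is locally a diffeomorphism. -/
theorem exists_openPartialHomeomorph {F : 𝔼 → 𝔼} {s : Set 𝔼} (hs : IsOpen s)
    (hF : ContDiffOn ℝ ∞ F s) (hinj : ∀ z ∈ s, Function.Injective (fderiv ℝ F z)) {y : 𝔼}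
    (hy : y ∈ s) : ∃ Φ : OpenPartialHomeomorph 𝔼 𝔼, y ∈ Φ.source ∧ Φ.source ⊆ s ∧
      (∀ z, Φ z = F z) ∧ ContDiffOn ℝ ∞ Φ.symm Φ.target := by
  have hFs : ∀ z ∈ s, ContDiffAt ℝ ∞ F z := fun z hz => hF.contDiffAt (hs.mem_nhds hz)
  have hD : ∀ z ∈ s, ∃ D : 𝔼 ≃L[ℝ] 𝔼, HasFDerivAt F (D : 𝔼 →L[ℝ] 𝔼) z := by
    intro z hz
    refine ⟨(LinearEquiv.ofInjectiveEndo (fderiv ℝ F z : 𝔼 →ₗ[ℝ] 𝔼)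
      (hinj z hz)).toContinuousLinearEquiv, ?_⟩
    exact (hFs z hz).differentiableAt_of_smooth.hasFDerivAt
  obtain ⟨D, hD₀⟩ := hD y hy
  have hsrc : (((hFs y hy).toOpenPartialHomeomorph F hD₀ (by simp)).restr s).source =
      ((hFs y hy).toOpenPartialHomeomorph F hD₀ (by simp)).source ∩ s :=
    OpenPartialHomeomorph.restr_source' _ s hs
  set Φ := ((hFs y hy).toOpenPartialHomeomorph F hD₀ (by simp)).restr s with hΦ
  have hcoe : ∀ z, Φ z = F z := fun z => by
    rw [hΦ, OpenPartialHomeomorph.restr_apply, ContDiffAt.toOpenPartialHomeomorph_coe]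
  have hcoe' : (Φ : 𝔼 → 𝔼) = F := funext hcoe
  refine ⟨Φ, ?_, ?_, hcoe, fun w hw => ?_⟩
  · rw [hsrc]
    exact ⟨(hFs y hy).mem_toOpenPartialHomeomorph_source hD₀ (by simp), hy⟩
  · rw [hsrc]
    exact inter_subset_right
  · have hz : Φ.symm w ∈ s := (hsrc.subset (Φ.map_target hw)).2
    obtain ⟨D', hD'⟩ := hD _ hz
    refine (Φ.contDiffAt_symm hw (f₀' := D') ?_ ?_).contDiffWithinAt
    · rwa [hcoe']
    · rw [hcoe']
      exact hFs _ hz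

/-- The chart around `p`, followed by a local isometry of the chart metric with Euclidean space. -/
theorem isLocallyEuclidean_of_flat {g : SmoothMetric n M}
    (h : ∀ x u v, OrthonormalPair g x u v → sec g x u v = 0) : IsLocallyEuclidean g := by
  intro p
  have hG := isMetricOn_chartMetric g p
  have hflat : ∀ z ∈ (extChartAt (𝓡 n) p).target, ∀ u v,
      curv (chr (chartMetric g p)) z u v = 0 := by
    intro z hz u v
    ext1 w
    rw [curv_eq_of_sec g (κ := fun _ => 0) h p z hz, zero_smul]
    rfl
  obtain ⟨r, hr, hball, F, hF, hFi⟩ := hG.exists_isometry_of_flat hflat (mem_extChartAt_target p)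
  obtain ⟨Φ, hpΦ, hΦs, hΦF, hΦ⟩ := exists_openPartialHomeomorph Metric.isOpen_ball hF
    (fun z hz => (injective_iff_map_eq_zero _).2 fun u hu => by
      by_contra h0
      have h1 := hG.pos z (hball hz) u h0
      rw [hFi z hz, hu, inner_zero_left] at h1
      exact h1.false) (Metric.mem_ball_self hr)
  have hΦF' : (Φ : 𝔼 → 𝔼) = F := funext hΦF
  have hchart : (extChartAt (𝓡 n) p : M → 𝔼) = chartAt 𝔼 p := by ext1 x; simp
  have hchart' : ((extChartAt (𝓡 n) p).symm : 𝔼 → M) = (chartAt 𝔼 p).symm := by ext1 x; simp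
  have hcoe : ∀ x, ((chartAt 𝔼 p).trans Φ) x = F (extChartAt (𝓡 n) p x) := fun x => by
    rw [OpenPartialHomeomorph.trans_apply, hΦF, hchart]
  have hsrc : ∀ x ∈ ((chartAt 𝔼 p).trans Φ).source,
      x ∈ (extChartAt (𝓡 n) p).source ∧ extChartAt (𝓡 n) p x ∈ Metric.ball
        (extChartAt (𝓡 n) p p) r := by
    intro x hx
    rw [OpenPartialHomeomorph.trans_source] at hx
    exact ⟨by simpa using hx.1, by rw [hchart]; exact hΦs hx.2⟩
  have hFat : ∀ z ∈ Metric.ball (extChartAt (𝓡 n) p p) r, ContDiffAt ℝ ∞ F z := fun z hz =>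
    hF.contDiffAt (Metric.isOpen_ball.mem_nhds hz)
  refine ⟨(chartAt 𝔼 p).trans Φ, ?_, ?_, ?_⟩
  · refine OpenPartialHomeomorph.mem_maximalAtlas_of_contMDiffOn _ ?_ ?_
    · intro x hx
      obtain ⟨h1, h2⟩ := hsrc x hx
      have := (hFat _ h2).contMDiffAt.comp x
        (contMDiffAt_extChartAt' (I := 𝓡 n) (n := ∞) (by simpa using h1))
      exact (this.congr_of_eventuallyEq (Eventually.of_forall hcoe)).contMDiffWithinAt
    · rw [OpenPartialHomeomorph.trans_symm_eq_symm_trans_symm]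
      intro w hw
      rw [OpenPartialHomeomorph.trans_target] at hw
      have h1 : Φ.symm w ∈ (extChartAt (𝓡 n) p).target := by simpa using hw.2
      have h2 := ((contMDiffOn_extChartAt_symm (I := 𝓡 n) (n := ∞) p).contMDiffAt
        ((isOpen_extChartAt_target p).mem_nhds h1)).comp w
        (hΦ.contDiffAt (Φ.open_target.mem_nhds hw.1)).contMDiffAt
      rw [hchart'] at h2
      exact h2.contMDiffWithinAt
  · rw [OpenPartialHomeomorph.trans_source]
    exact ⟨mem_chart_source 𝔼 p, by rw [mem_preimage, ← hchart]; exact hpΦ⟩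
  · intro x hx u v
    obtain ⟨h1, h2⟩ := hsrc x hx
    have hder : ∀ w : TangentSpace (𝓡 n) x, euclDeriv ((chartAt 𝔼 p).trans Φ) x w =
        fderiv ℝ F (extChartAt (𝓡 n) p x) (chartVec p x w) := by
      intro w
      have h3 : ((chartAt 𝔼 p).trans Φ : M → 𝔼) = F ∘ extChartAt (𝓡 n) p := funext hcoe
      have h4 := mfderiv_comp x
        (hFat _ h2).differentiableAt_of_smooth.mdifferentiableAt
        (mdifferentiableAt_extChartAt (I := 𝓡 n) (by simpa using h1))
      rw [euclDeriv, h3, h4, mfderiv_eq_fderiv]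
      rfl
    rw [hder, hder, ← hFi _ h2, chartMetric_chartVec g h1]

/-! ### The weighted sectional curvatures -/

theorem exists_lieDeriv_eq (hn : 2 < n) (g : SmoothMetric n M)
    (X : ∀ x : M, TangentSpace (𝓡 n) x) (x : M)
    (h : ∀ u v, OrthonormalPair g x u v → lieDeriv g X x u u = lieDeriv g X x v v) :
    ∃ c, ∀ u v, lieDeriv g X x u v = c * g.inner x u v :=
  (isMetricOn_metricForm g x).exists_eq_mul (mem_univ (0 : 𝔼)) (by simpa using hn)
    (lieDeriv_add_left g X x) (lieDeriv_smul_left g X x) (lieDeriv_symm g X x)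
    fun u v hu hv huv => h u v ⟨hu, hv, huv⟩

theorem exists_orthonormalPair (hn : 2 < n) (g : SmoothMetric n M) (x : M) :
    ∃ u v, OrthonormalPair g x u v := by
  have hG := isMetricOn_metricForm g x
  have hE : 2 < Module.finrank ℝ 𝔼 := by simpa using hn
  obtain ⟨u, hu, -⟩ := hG.exists_unit_orthogonal (mem_univ (0 : 𝔼)) hE 0 0
  obtain ⟨v, hv, huv, -⟩ := hG.exists_unit_orthogonal (mem_univ (0 : 𝔼)) hE u u
  exact ⟨u, v, hu, hv, huv⟩

/-- Since `sec(V, U)` is symmetric, an isotropic `sec_X` forces `L_X g` to be isotropic too. -/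
theorem isConformalField_of_weightedSecEq (hn : 2 < n) {g : SmoothMetric n M}
    {X : ∀ x : M, TangentSpace (𝓡 n) x} {ψ : M → ℝ} (h : WeightedSecEq g X ψ) :
    IsConformalField g X := by
  choose φ hφ using fun x => exists_lieDeriv_eq hn g X x fun u v huv => by
    have h1 := h x u v huv
    have h2 := h x v u huv.swap
    rw [weightedSec] at h1 h2
    rw [sec_symm huv] at h1
    linarith
  exact ⟨φ, hφ⟩

theorem hasConstantCurvature_of_weightedSecEq [ConnectedSpace M] (hn : 2 < n)
    {g : SmoothMetric n M} {X : ∀ x : M, TangentSpace (𝓡 n) x} {ψ : M → ℝ}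
    (h : WeightedSecEq g X ψ) : HasConstantCurvature g := by
  obtain ⟨φ, hφ⟩ := isConformalField_of_weightedSecEq hn h
  refine hasConstantCurvature_of_sec hn (κ := fun x => ψ x - 1 / 2 * φ x) fun x u v huv => ?_
  have h1 := h x u v huv
  rw [weightedSec, hφ, huv.1] at h1
  linarith

theorem weightedSec_isotropic_iff [ConnectedSpace M] (hn : 2 < n) (g : SmoothMetric n M)
    (X : ∀ x : M, TangentSpace (𝓡 n) x) :
    (∃ ψ : M → ℝ, WeightedSecEq g X ψ) ↔ HasConstantCurvature g ∧ IsConformalField g X := by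
  constructor
  · rintro ⟨ψ, h⟩
    exact ⟨hasConstantCurvature_of_weightedSecEq hn h, isConformalField_of_weightedSecEq hn h⟩
  · rintro ⟨⟨ρ, hρ⟩, φ, hφ⟩
    refine ⟨fun x => ρ + 1 / 2 * φ x, fun x u v huv => ?_⟩
    rw [weightedSec, hρ x u v huv, hφ, huv.1, mul_one]

/-- When `sec_X` is constant, `X` is homothetic for a constant curvature metric, so either the
curvature or the homothety factor vanishes. -/
theorem killing_or_flat_of_weightedSecEq_const [ConnectedSpace M] (hn : 2 < n)
    {g : SmoothMetric n M} {X : ∀ x : M, TangentSpace (𝓡 n) x}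
    (hX : ContMDiff (𝓡 n) (𝓡 n).tangent ∞ (fun x => (⟨x, X x⟩ : TangentBundle (𝓡 n) M)))
    {K : ℝ} (h : WeightedSecEq g X (fun _ => K)) :
    IsKillingField g X ∨ (IsLocallyEuclidean g ∧ IsHomotheticField g X (2 * K)) := by
  obtain ⟨φ, hφ⟩ := isConformalField_of_weightedSecEq hn h
  obtain ⟨ρ, hρ⟩ := hasConstantCurvature_of_weightedSecEq hn h
  -- The conformal factor is the constant `2 (K - ρ)`.
  have hc : ∀ x, φ x = 2 * (K - ρ) := by
    intro x
    obtain ⟨u, v, huv⟩ := exists_orthonormalPair hn g x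
    have h1 := h x u v huv
    rw [weightedSec, hφ, huv.1, hρ x u v huv] at h1
    linarith
  have hL : ∀ x u v, lieDeriv g X x u v = 2 * (K - ρ) * g.inner x u v := fun x u v => by
    rw [hφ, hc]
  have hXs := contDiffOn_chartField hX
  obtain ⟨p⟩ := (inferInstance : Nonempty M)
  have hprod : ρ * (2 * (K - ρ)) = 0 := by
    refine (isMetricOn_chartMetric g p).mul_eq_zero_of_homothetic (hXs p)
      (by simpa using hn) (curv_eq_of_sec g (κ := fun _ => ρ) hρ p) ?_ (mem_extChartAt_target p)
    intro z hz u v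
    obtain ⟨x, hx, rfl⟩ : ∃ x ∈ (extChartAt (𝓡 n) p).source, extChartAt (𝓡 n) p x = z :=
      ⟨_, (extChartAt (𝓡 n) p).map_target hz, (extChartAt (𝓡 n) p).right_inv hz⟩
    obtain ⟨u, rfl⟩ := chartVec_surjective hx u
    obtain ⟨v, rfl⟩ := chartVec_surjective hx v
    rw [← lieDeriv_eq g hXs hx, hL, chartMetric_chartVec g hx]
  rcases mul_eq_zero.1 hprod with h0 | h0
  · right
    subst h0
    exact ⟨isLocallyEuclidean_of_flat hρ, fun x u v => by rw [hL, sub_zero]⟩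
  · left
    intro x u v
    rw [hL, h0, zero_mul]

theorem weightedHess_add_left (g : SmoothMetric n M) (f : M → ℝ) (x : M)
    (u v w : TangentSpace (𝓡 n) x) :
    weightedHess g f x (u + v) w = weightedHess g f x u w + weightedHess g f x v w := by
  simp only [weightedHess, lieDeriv_add_left, map_add]
  ring

theorem weightedHess_smul_left (g : SmoothMetric n M) (f : M → ℝ) (x : M) (a : ℝ)
    (u w : TangentSpace (𝓡 n) x) :
    weightedHess g f x (a • u) w = a * weightedHess g f x u w := by
  simp only [weightedHess, lieDeriv_smul_left, map_smul, smul_eq_mul]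
  ring

theorem weightedHess_symm (g : SmoothMetric n M) (f : M → ℝ) (x : M)
    (u w : TangentSpace (𝓡 n) x) : weightedHess g f x u w = weightedHess g f x w u := by
  rw [weightedHess, weightedHess, lieDeriv_symm, mul_comm (g.inner x (gradient g f x) u)]

theorem exists_weightedHess_eq (hn : 2 < n) (g : SmoothMetric n M) (f : M → ℝ) (x : M)
    (h : ∀ u v, OrthonormalPair g x u v → weightedHess g f x u u = weightedHess g f x v v) :
    ∃ c, ∀ u v, weightedHess g f x u v = c * g.inner x u v :=
  (isMetricOn_metricForm g x).exists_eq_mul (mem_univ (0 : 𝔼)) (by simpa using hn)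
    (weightedHess_add_left g f x) (weightedHess_smul_left g f x) (weightedHess_symm g f x)
    fun u v hu hv huv => h u v ⟨hu, hv, huv⟩

theorem exists_weightedHess_eq_of_add (hn : 2 < n) (g : SmoothMetric n M) (f : M → ℝ) (x : M)
    {k : ℝ}
    (h : ∀ u v, OrthonormalPair g x u v → weightedHess g f x u u + weightedHess g f x v v = k) :
    ∃ c, ∀ u v, weightedHess g f x u v = c * g.inner x u v :=
  (isMetricOn_metricForm g x).exists_eq_mul_of_add_eq (mem_univ (0 : 𝔼)) (by simpa using hn)
    (weightedHess_add_left g f x) (weightedHess_smul_left g f x) (weightedHess_symm g f x)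
    fun u v hu hv huv => h u v ⟨hu, hv, huv⟩

theorem weightedSecBar_gradient (g : SmoothMetric n M) (f : M → ℝ) (x : M)
    (u v : TangentSpace (𝓡 n) x) :
    weightedSecBar g (gradient g f) x u v = sec g x u v + weightedHess g f x u u := by
  rw [weightedSecBar, weightedHess]
  ring

/-- In both directions `weightedHess` is a multiple of `g`: if the strongly weighted curvature is
isotropic because `sec` is symmetric, and if both metrics have constant curvature because
`sec_conformal` fixes the sum of its values at the two vectors of each orthonormal pair. -/
theorem weightedSecBar_isotropic_iff [ConnectedSpace M] (hn : 2 < n) (g : SmoothMetric n M)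
    {f : M → ℝ} (hf : ContMDiff (𝓡 n) 𝓘(ℝ, ℝ) ∞ f) :
    (∃ ψ : M → ℝ, WeightedSecBarEq g (gradient g f) ψ) ↔
      HasConstantCurvature g ∧ HasConstantCurvature (conformalMetric g f hf) := by
  constructor
  · rintro ⟨ψ, h⟩
    have hq := fun x => exists_weightedHess_eq hn g f x fun u v huv => by
      have h1 := h x u v huv
      have h2 := h x v u huv.swap
      rw [weightedSecBar_gradient] at h1 h2
      rw [sec_symm huv] at h1
      linarith
    choose q hq using hq
    have hsec : ∀ x u v, OrthonormalPair g x u v → sec g x u v = ψ x - q x := by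
      intro x u v huv
      have h1 := h x u v huv
      rw [weightedSecBar_gradient, hq, huv.1] at h1
      linarith
    refine ⟨hasConstantCurvature_of_sec hn hsec, hasConstantCurvature_of_sec hn
      (κ := fun x => Real.exp (2 * f x) *
        (ψ x - q x + q x + q x - g.inner x (gradient g f x) (gradient g f x))) fun x => ?_⟩
    refine (sec_conformal_eq_iff g hf x _).2 fun u v huv => ?_
    rw [sec_conformal g hf huv, hsec x u v huv, hq, hq, huv.1, huv.2.1, mul_one]
  · rintro ⟨⟨ρ, hρ⟩, ρ', hρ'⟩
    have hq := fun x => exists_weightedHess_eq_of_add hn g f x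
      (k := Real.exp (-(2 * f x)) * ρ' - ρ + g.inner x (gradient g f x) (gradient g f x))
      fun u v huv => by
        have h1 := (sec_conformal_eq_iff g hf x ρ').1 (hρ' x) u v huv
        rw [sec_conformal g hf huv, hρ x u v huv] at h1
        rw [← h1, ← mul_assoc, ← Real.exp_add, neg_add_cancel, Real.exp_zero]
        ring
    choose q hq using hq
    refine ⟨fun x => ρ + q x, fun x u v huv => ?_⟩
    rw [weightedSecBar_gradient, hρ x u v huv, hq, huv.1, mul_one]

end Manifold

end WeightedSec

end

theorem proposition1p1 {n : ℕ} (hn : 2 < n) {M : Type*} [TopologicalSpace M]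
    [ChartedSpace (EuclideanSpace ℝ (Fin n)) M] [IsManifold (𝓡 n) ∞ M]
    [T2Space M] [ConnectedSpace M]
    (g : WeightedSec.SmoothMetric n M)
    (X : ∀ x : M, TangentSpace (𝓡 n) x)
    (hX : ContMDiff (𝓡 n) (𝓡 n).tangent ∞ (fun x => (⟨x, X x⟩ : TangentBundle (𝓡 n) M)))
    (f : M → ℝ) (hf : ContMDiff (𝓡 n) 𝓘(ℝ, ℝ) ∞ f) :
    ((∃ ψ : M → ℝ, WeightedSec.WeightedSecEq g X ψ) ↔
        WeightedSec.HasConstantCurvature g ∧ WeightedSec.IsConformalField g X) ∧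
    (∀ K : ℝ, WeightedSec.WeightedSecEq g X (fun _ => K) →
        WeightedSec.IsKillingField g X ∨
          (WeightedSec.IsLocallyEuclidean g ∧ WeightedSec.IsHomotheticField g X (2 * K))) ∧
    ((∃ ψ : M → ℝ, WeightedSec.WeightedSecBarEq g (WeightedSec.gradient g f) ψ) ↔
        WeightedSec.HasConstantCurvature g ∧
          WeightedSec.HasConstantCurvature (WeightedSec.conformalMetric g f hf)) :=
  ⟨WeightedSec.weightedSec_isotropic_iff hn g X,
    fun _ h => WeightedSec.killing_or_flat_of_weightedSecEq_const hn hX h,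
    WeightedSec.weightedSecBar_isotropic_iff hn g hf⟩
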